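/- Conventions. Graphs are finite and simple; a cubic graph is a connected $3$-regular graph. An embedding of a connected graph $G$ is a combinatorial embedding in a closed oriented surface (a rotation system), that is, an assignment to each vertex of a cyclic order $\mathrm{nx}$ of the directed edges starting there. Its faces are the cyclic sequences of directed edges in which $e$ is followed by $\mathrm{nx}(e^{-1})$, and its genus $g$ is given by Euler's formula $|V|-|E|+|F|=2-2g$. The mirror image reverses all the cyclic orders. An embedding is polyhedral if each facial walk is a simple cycle and any two distinct faces intersect in nothing, in a single vertex, or in a single edge. An isomorphism of embedded graphs is a graph isomorphism that respects all the cyclic orders or reverses all of them. Let $\mathrm{mingen}(G)$ be the smallest genus of an embedding of $G$, and let $n_g(G)$ be the number of polyhedral embeddings of $G$ in genus $g$, mirror images being identified. Theorem. For each integer $k>0$ there is (a) a cubic graph $G$ admitting two polyhedral embeddings whose genera differ by at least $k$, such that $G$ has no polyhedral embedding in any genus strictly between these two genera; (b) a cubic graph $G$ admitting polyhedral embeddings in at least $k$ different genera; (c) a cubic graph $G$ and a genus $g$ with $n_g(G)\ge k$, and also a cubic graph with at least $k$ pairwise non-isomorphic polyhedral embeddings in one and the same genus. In fact, for every genus $g\ge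 0$ there is a cubic graph $G$ with $n_g(G)\ge 8^g$, and there is a cubic graph with at least $8^g$ pairwise non-isomorphic polyhedral embeddings in genus $g$; (d) a cubic graph $G$ that has a polyhedral embedding and for which the smallest genus of a polyhedral embedding of $G$ is at least $\mathrm{mingen}(G)+k$. -/

import Mathlib

/-- A (finite, simple, connected) cubic graph. -/
structure IsCubicGraph {V : Type*} (G : SimpleGraph V) : Prop where
  finite : Finite V
  connected : G.Connected
  degree_eq_three : ∀ v, (G.neighborSet v).ncard = 3

/-- A combinatorial embedding of a graph in a closed oriented surface: a rotation system.
The darts of `G` are its directed edges; `nx` sends a directed edge to the next one in the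
cyclic order around its start vertex, so `nx` permutes the directed edges starting at each
vertex in a single cycle. -/
@[ext]
structure RotationSystem {V : Type*} (G : SimpleGraph V) where
  nx : Equiv.Perm G.Dart
  fst_nx : ∀ d, (nx d).fst = d.fst
  sameCycle_nx : ∀ d d', d.fst = d'.fst → nx.SameCycle d d'

namespace RotationSystem

variable {V W : Type*} {G : SimpleGraph V} {H : SimpleGraph W}

/-- The facial walk containing the directed edge `e` continues with `nx (e⁻¹)`. -/
def faceNext (R : RotationSystem G) : Equiv.Perm G.Dart :=
  (Function.Involutive.toPerm SimpleGraph.Dart.symm SimpleGraph.Dart.symm_involutive).trans R.nx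

/-- Two directed edges lie on the same facial walk. -/
def SameFace (R : RotationSystem G) (d d' : G.Dart) : Prop :=
  R.faceNext.SameCycle d d'

/-- The faces are the cyclic orbits of `faceNext`. -/
def Face (R : RotationSystem G) : Type _ :=
  Quotient (Equiv.Perm.SameCycle.setoid R.faceNext)

/-- The vertices on the face containing the directed edge `d`. -/
def faceVerts (R : RotationSystem G) (d : G.Dart) : Set V :=
  {v | ∃ d', R.SameFace d d' ∧ d'.fst = v}

/-- The (undirected) edges on the face containing the directed edge `d`. -/
def faceEdges (R : RotationSystem G) (d : G.Dart) : Set (Sym2 V) :=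
  {e | ∃ d', R.SameFace d d' ∧ d'.edge = e}

/-- The genus of an embedding of a finite connected graph with at least one edge, by Euler's
formula `|V| - |E| + |F| = 2 - 2g`. -/
def HasGenus (R : RotationSystem G) (g : ℕ) : Prop :=
  (Nat.card V : ℤ) - Nat.card G.edgeSet + Nat.card R.Face = 2 - 2 * g

/-- Polyhedral embeddings: each facial walk is a simple cycle (it visits no vertex twice, and it
is not just an edge traversed back and forth), and two distinct faces intersect in nothing, in a
single vertex, or in a single edge (together with its two endpoints). -/
structure IsPolyhedral (R : RotationSystem G) : Prop where
  vertex_simple : ∀ d d', R.SameFace d d' → d.fst = d'.fst → d = d'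
  edge_simple : ∀ d : G.Dart, ¬ R.SameFace d d.symm
  inter : ∀ d d', ¬ R.SameFace d d' →
    (R.faceVerts d ∩ R.faceVerts d' = ∅ ∧ R.faceEdges d ∩ R.faceEdges d' = ∅) ∨
    (∃ v, R.faceVerts d ∩ R.faceVerts d' = {v} ∧ R.faceEdges d ∩ R.faceEdges d' = ∅) ∨
    (∃ u v, R.faceVerts d ∩ R.faceVerts d' = {u, v} ∧
      R.faceEdges d ∩ R.faceEdges d' = {s(u, v)})

/-- The mirror image: all cyclic orders are reversed. -/
def mirror (R : RotationSystem G) : RotationSystem G where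
  nx := R.nx⁻¹
  fst_nx d := by
    have h := R.fst_nx (R.nx.symm d)
    rw [Equiv.apply_symm_apply] at h
    exact h.symm
  sameCycle_nx d d' h := (R.sameCycle_nx d d' h).inv

/-- Isomorphism of embedded graphs: a graph isomorphism that respects all cyclic orders or
reverses all of them. -/
def Isomorphic (R : RotationSystem G) (S : RotationSystem H) : Prop :=
  ∃ φ : G ≃g H,
    (∀ d, φ.toHom.mapDart (R.nx d) = S.nx (φ.toHom.mapDart d)) ∨
    (∀ d, φ.toHom.mapDart (R.nx d) = S.mirror.nx (φ.toHom.mapDart d))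

theorem mirror_mirror (R : RotationSystem G) : R.mirror.mirror = R := by
  ext1
  exact inv_inv R.nx

/-- Embeddings of `G` that are equal or mirror images of each other are identified. -/
def mirrorSetoid (G : SimpleGraph V) : Setoid (RotationSystem G) where
  r R S := S = R ∨ S = R.mirror
  iseqv :=
    { refl := fun _ => Or.inl rfl
      symm := by
        rintro R S (rfl | rfl)
        · exact Or.inl rfl
        · exact Or.inr (mirror_mirror R).symm
      trans := by
        rintro R S T (rfl | rfl) (rfl | rfl)
        · exact Or.inl rfl
        · exact Or.inr rfl
        · exact Or.inr rfl
        · exact Or.inl (mirror_mirror R) }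

end RotationSystem

/-- The genera in which `G` can be embedded. -/
def embeddingGenera {V : Type*} (G : SimpleGraph V) : Set ℕ :=
  {g | ∃ R : RotationSystem G, R.HasGenus g}

/-- The genera in which `G` has a polyhedral embedding. -/
def polyhedralGenera {V : Type*} (G : SimpleGraph V) : Set ℕ :=
  {g | ∃ R : RotationSystem G, R.IsPolyhedral ∧ R.HasGenus g}

/-- `n_g(G)`: the number of different polyhedral embeddings of `G` in genus `g`, mirror images
being identified. -/
noncomputable def numPolyhedral {V : Type*} (G : SimpleGraph V) (g : ℕ) : ℕ :=
  (Quotient.mk (RotationSystem.mirrorSetoid G) ''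
    {R | R.IsPolyhedral ∧ R.HasGenus g}).ncard

/-- `G` has (at least) `N` pairwise non-isomorphic polyhedral embeddings in genus `g`. -/
def HasNonisomorphicPolyhedral {V : Type*} (G : SimpleGraph V) (g N : ℕ) : Prop :=
  ∃ P : Fin N → RotationSystem G,
    (∀ i, (P i).IsPolyhedral ∧ (P i).HasGenus g) ∧
    ∀ i j, i ≠ j → ¬ (P i).Isomorphic (P j)

/-!
A rotation system on a cubic graph is a choice of one of two orientations at each vertex, and a
vertex of degree three makes the polyhedral condition local: an embedding is polyhedral if and only
if the three faces at each vertex are distinct and no two edges have the same pair of faces on their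
two sides (`CubicData.Labelling.isPolyhedral_iff`). For a given graph with orientations this is a
finite check on a table of faces. Infinite families come from two constructions.

*Cyclic covers.* A base graph with voltages in `ℤ` has a cover of order `n`. If the voltages add up
to zero along the faces of an embedding of the base, then `n` lifts of these faces are the faces
of an embedding of the cover, and a finite condition on the base makes it polyhedral for all large
`n` (`CubicData.CoverGood.good`). The covers used here are pairs of closed ladders whose cells are
pentagons, with links between the ladders. In a polyhedral embedding the orientations along a
chordless 5-cycle which is a face for the constant orientation agree (`CubicData.eq_of_five_cycle`).
Adjacent cells share a rung, so up to mirror images only two embeddings of the pair of ladders can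
be polyhedral (`CubicData.LadderPair.HasPentagons.exists_eq`): those in which the ladders have equal
or opposite orientations. With `42 * n` vertices and `17 * n` or `15 * n` faces, their genera are
`2 * n + 1` and `3 * n + 1`. If both are polyhedral (`CubicData.LadderPair.twoGenera`), then these
are the only polyhedral genera, and they differ by `n`; if only the one with fewer faces is
polyhedral (`CubicData.LadderPair.highGenus`), then the smallest polyhedral genus exceeds the
smallest genus by at least `n`.

*Star products.* Deleting a vertex from each of two cubic graphs and joining the neighbours in pairs
makes polyhedral embeddings of the two factors into a polyhedral embedding, and adds the genera
(`CubicData.PolyGenus.star`). Repeated products with one graph that has polyhedral embeddings of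
genera 121 and 181 give arbitrarily many genera. Repeated products with a graph that has eight
polyhedral embeddings in the torus give `8 ^ g` embeddings of genus `g`. This graph is the Heawood
graph with some vertices blown up so as to destroy all symmetries: the products have no
automorphisms (`CubicData.decoratedHeawood_star_rigid`), whence their embeddings can be isomorphic
only if they are equal or mirror images of each other.
-/

/-! ### Cubic graphs with numbered darts, and their rotation systems -/

/-- A cubic graph with numbered darts: `(v, t)` is the dart with number `t` starting at `v`, and
`inv` reverses the darts. The conditions `fst_ne` and `inj` exclude loops and multiple edges. -/
structure CubicData (V : Type*) where
  inv : V × Fin 3 → V × Fin 3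
  inv_inv : ∀ d, inv (inv d) = d
  fst_ne : ∀ d, (inv d).1 ≠ d.1
  inj : ∀ v s t, (inv (v, s)).1 = (inv (v, t)).1 → s = t

namespace CubicData

variable {V : Type*} (C : CubicData V)

/-- The underlying simple graph. -/
def graph : SimpleGraph V where
  Adj u v := ∃ t, (C.inv (u, t)).1 = v
  symm := ⟨by
    rintro u v ⟨t, rfl⟩
    exact ⟨(C.inv (u, t)).2, by rw [Prod.mk.eta, C.inv_inv]⟩⟩
  loopless := ⟨fun v ⟨t, h⟩ => C.fst_ne (v, t) h⟩

theorem dart_ext {d d' : V × Fin 3} (h : d.1 = d'.1) (h' : (C.inv d).1 = (C.inv d').1) :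
    d = d' := by
  obtain ⟨v, s⟩ := d
  obtain ⟨w, t⟩ := d'
  obtain rfl : v = w := h
  rw [C.inj v s t h']

/-- The dart of the graph with a given number. -/
def dart (d : V × Fin 3) : C.graph.Dart := ⟨(d.1, (C.inv d).1), d.2, rfl⟩

@[simp] theorem dart_fst (d : V × Fin 3) : (C.dart d).fst = d.1 := rfl

theorem dart_bijective : Function.Bijective C.dart := by
  constructor
  · intro d d' h
    exact C.dart_ext (congrArg (fun e => e.fst) h) (congrArg (fun e => e.snd) h)
  · rintro ⟨⟨u, v⟩, t, ht⟩
    refine ⟨(u, t), SimpleGraph.Dart.ext _ _ ?_⟩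
    exact Prod.ext rfl ht

/-- The darts of the graph are the pairs of a vertex and a number. -/
noncomputable def dartEquiv : V × Fin 3 ≃ C.graph.Dart :=
  Equiv.ofBijective C.dart C.dart_bijective

@[simp] theorem dartEquiv_apply (d : V × Fin 3) : C.dartEquiv d = C.dart d := rfl

@[simp] theorem dartEquiv_symm_dart (d : V × Fin 3) : C.dartEquiv.symm (C.dart d) = d :=
  C.dartEquiv.symm_apply_apply d

theorem dart_inv (d : V × Fin 3) : C.dart (C.inv d) = (C.dart d).symm := by
  apply SimpleGraph.Dart.ext
  exact Prod.ext rfl (by simp [dart, C.inv_inv])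

/-- The number of the next dart at a vertex of orientation `b`. A set of three elements has only two
cyclic orders, so a rotation system on a cubic graph amounts to a Boolean for each vertex. -/
def turn (b : Bool) (t : Fin 3) : Fin 3 := if b then t + 1 else t + 2

theorem turn_not_turn (b : Bool) (t : Fin 3) : turn (!b) (turn b t) = t := by
  revert b t; decide

theorem turn_turn_not (b : Bool) (t : Fin 3) : turn b (turn (!b) t) = t := by
  revert b t; decide

theorem turn_turn (b : Bool) (t : Fin 3) : turn b (turn b t) = turn (!b) t := by
  revert b t; decide

theorem turn_ne (b : Bool) (t : Fin 3) : turn b t ≠ t := by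
  revert b t; decide

theorem eq_turn (b : Bool) (s t : Fin 3) : t = s ∨ t = turn b s ∨ s = turn b t := by
  revert b s t; decide

/-- The next dart at the same vertex, the vertex `v` having the orientation `σ v`. -/
def next (σ : V → Bool) : Equiv.Perm (V × Fin 3) where
  toFun d := (d.1, turn (σ d.1) d.2)
  invFun d := (d.1, turn (!σ d.1) d.2)
  left_inv _ := Prod.ext rfl (turn_not_turn _ _)
  right_inv _ := Prod.ext rfl (turn_turn_not _ _)

@[simp] theorem next_apply (σ : V → Bool) (d : V × Fin 3) :
    next σ d = (d.1, turn (σ d.1) d.2) := rfl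

/-- The reversal of darts as a permutation. -/
def invPerm : Equiv.Perm (V × Fin 3) := Function.Involutive.toPerm C.inv C.inv_inv

/-- The step along the faces: reverse the dart and turn. -/
def face (σ : V → Bool) : Equiv.Perm (V × Fin 3) := C.invPerm.trans (next σ)

theorem face_apply (σ : V → Bool) (d : V × Fin 3) :
    C.face σ d = ((C.inv d).1, turn (σ (C.inv d).1) (C.inv d).2) := rfl

theorem face_inv (σ : V → Bool) (d : V × Fin 3) :
    C.face σ (C.inv d) = (d.1, turn (σ d.1) d.2) := by
  rw [face_apply, C.inv_inv]

theorem sameCycle_permCongr {α β : Type*} (e : α ≃ β) (p : Equiv.Perm α) (x y : α) :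
    (e.permCongr p).SameCycle (e x) (e y) ↔ p.SameCycle x y := by
  have h : ∀ k : ℤ, ((e.permCongr p) ^ k) (e x) = e ((p ^ k) x) := by
    intro k
    have := map_zpow (Equiv.permCongrHom e) p k
    have h2 : (e.permCongr p) ^ k = e.permCongr (p ^ k) := this.symm
    rw [h2]; simp [Equiv.permCongr_apply]
  simp only [Equiv.Perm.SameCycle, h, e.apply_eq_iff_eq]

theorem sameCycle_next (σ : V → Bool) (v : V) (s t : Fin 3) :
    (next σ).SameCycle (v, s) (v, t) := by
  rcases eq_turn (σ v) s t with rfl | rfl | rfl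
  · rfl
  · exact ⟨1, rfl⟩
  · exact Equiv.Perm.SameCycle.symm ⟨1, rfl⟩

/-- The rotation system in which the vertex `v` has orientation `σ v`. -/
noncomputable def rot (σ : V → Bool) : RotationSystem C.graph where
  nx := C.dartEquiv.permCongr (next σ)
  fst_nx d := by
    obtain ⟨d, rfl⟩ := C.dartEquiv.surjective d
    simp [Equiv.permCongr_apply]
  sameCycle_nx d d' h := by
    obtain ⟨d, rfl⟩ := C.dartEquiv.surjective d
    obtain ⟨d', rfl⟩ := C.dartEquiv.surjective d'
    rw [sameCycle_permCongr]
    obtain ⟨v, s⟩ := d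
    obtain ⟨w, t⟩ := d'
    obtain rfl : v = w := h
    exact sameCycle_next σ v s t

theorem rot_nx (σ : V → Bool) (d : V × Fin 3) :
    (C.rot σ).nx (C.dart d) = C.dart (d.1, turn (σ d.1) d.2) := by
  rw [← dartEquiv_apply]
  simp [rot, Equiv.permCongr_apply]

theorem rot_faceNext (σ : V → Bool) : (C.rot σ).faceNext = C.dartEquiv.permCongr (C.face σ) := by
  ext1 d
  obtain ⟨d, rfl⟩ := C.dartEquiv.surjective d
  have : (C.rot σ).faceNext (C.dart d) = (C.rot σ).nx (C.dart d).symm := rfl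
  rw [dartEquiv_apply, this, ← dart_inv, rot_nx, ← dartEquiv_apply]
  simp [Equiv.permCongr_apply, face_apply]

theorem sameFace_iff (σ : V → Bool) (d d' : V × Fin 3) :
    (C.rot σ).SameFace (C.dart d) (C.dart d') ↔ (C.face σ).SameCycle d d' := by
  rw [RotationSystem.SameFace, rot_faceNext, ← dartEquiv_apply, ← dartEquiv_apply,
    sameCycle_permCongr]

/-- Every rotation system is given by orientations of the vertices. -/
theorem exists_rot_eq (R : RotationSystem C.graph) : ∃ σ, R = C.rot σ := by
  -- the rotation at `v` acts on `Fin 3` without fixed points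
  have key : ∀ v, ∃ b, ∀ t, R.nx (C.dart (v, t)) = C.dart (v, turn b t) := by
    intro v
    have h1 : ∀ t, ∃ s, R.nx (C.dart (v, t)) = C.dart (v, s) := by
      intro t
      obtain ⟨⟨w, s⟩, hd⟩ := C.dart_bijective.2 (R.nx (C.dart (v, t)))
      have := R.fst_nx (C.dart (v, t))
      rw [← hd] at this
      obtain rfl : w = v := this
      exact ⟨s, hd.symm⟩
    choose f hf using h1
    have hinj : Function.Injective f := by
      intro s t h
      have : R.nx (C.dart (v, s)) = R.nx (C.dart (v, t)) := by rw [hf, hf, h]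
      have := C.dart_bijective.1 (R.nx.injective this)
      exact (Prod.mk.inj this).2
    have hne : ∀ t, f t ≠ t := by
      intro t ht
      have hfix : R.nx (C.dart (v, t)) = C.dart (v, t) := by rw [hf, ht]
      obtain ⟨k, hk⟩ := R.sameCycle_nx (C.dart (v, t)) (C.dart (v, t + 1)) rfl
      rw [Equiv.Perm.zpow_apply_eq_self_of_apply_eq_self hfix] at hk
      have := (Prod.mk.inj (C.dart_bijective.1 hk)).2
      clear hfix hk ht
      revert t
      decide
    have hb : ∃ b, ∀ t, f t = turn b t := by
      clear hf
      revert f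
      decide
    obtain ⟨b, hb⟩ := hb
    exact ⟨b, fun t => by rw [hf, hb]⟩
  choose σ hσ using key
  refine ⟨σ, RotationSystem.ext (Equiv.ext fun d => ?_)⟩
  obtain ⟨⟨v, t⟩, rfl⟩ := C.dart_bijective.2 d
  rw [hσ, rot_nx]

theorem rot_injective : Function.Injective C.rot := by
  intro σ τ h
  funext v
  have h1 : (C.rot σ).nx (C.dart (v, 0)) = (C.rot τ).nx (C.dart (v, 0)) := by rw [h]
  rw [rot_nx, rot_nx] at h1
  have h2 : turn (σ v) 0 = turn (τ v) 0 := (Prod.mk.inj (C.dart_bijective.1 h1)).2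
  have h3 : ∀ a b, turn a 0 = turn b 0 → a = b := by decide
  exact h3 _ _ h2

theorem mirror_rot (σ : V → Bool) : (C.rot σ).mirror = C.rot (fun v => !σ v) := by
  refine RotationSystem.ext (Equiv.ext fun d => ?_)
  obtain ⟨⟨v, t⟩, rfl⟩ := C.dart_bijective.2 d
  have : (C.rot σ).mirror.nx = (C.rot σ).nx⁻¹ := rfl
  rw [this, rot_nx, Equiv.Perm.inv_eq_iff_eq, rot_nx]
  simp [turn_turn_not]

/-! ### Polyhedral embeddings in terms of face labels -/

/-- A labelling of the darts by their faces: the fibres of `L` are the orbits of `C.face σ`, so that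
`Λ` stands for the set of faces. -/
structure Labelling (σ : V → Bool) (Λ : Type*) where
  L : V × Fin 3 → Λ
  face_eq : ∀ d, L (C.face σ d) = L d
  sameCycle : ∀ d d', L d = L d' → (C.face σ).SameCycle d d'
  surj : Function.Surjective L

variable {C}
namespace Labelling

variable {σ : V → Bool} {Λ : Type*} (ℓ : C.Labelling σ Λ)

/-- The condition on the labels that characterizes polyhedral embeddings: the three faces at a
vertex are distinct, and at most one dart has a given face on its left and a given one on its
right. -/
structure Good : Prop where
  vertex : ∀ v s t, ℓ.L (v, s) = ℓ.L (v, t) → s = t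
  edge : ∀ d d', ℓ.L d = ℓ.L d' → ℓ.L (C.inv d) = ℓ.L (C.inv d') → d = d'

theorem _root_.CubicData.invariant_of_sameCycle {α X : Type*} {p : Equiv.Perm α} {f : α → X}
    (hf : ∀ a, f (p a) = f a) {a b : α} (h : p.SameCycle a b) : f a = f b := by
  have hn : ∀ (n : ℕ) a, f ((p ^ n) a) = f a := by
    intro n
    induction n with
    | zero => intro a; rfl
    | succ n ih => intro a; rw [pow_succ, Equiv.Perm.mul_apply, ih, hf]
  obtain ⟨k, rfl⟩ := h
  obtain ⟨n, rfl | rfl⟩ := k.eq_nat_or_neg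
  · exact (hn n a).symm
  · have := hn n ((p ^ (-(n : ℤ))) a)
    rw [← this, zpow_neg, zpow_natCast, ← Equiv.Perm.mul_apply, mul_inv_cancel,
      Equiv.Perm.one_apply]

theorem eq_iff (d d' : V × Fin 3) : ℓ.L d = ℓ.L d' ↔ (C.face σ).SameCycle d d' :=
  ⟨ℓ.sameCycle d d', invariant_of_sameCycle ℓ.face_eq⟩

theorem invariant {X : Type*} {f : V × Fin 3 → X} (hf : ∀ d, f (C.face σ d) = f d)
    {d d' : V × Fin 3} (h : ℓ.L d = ℓ.L d') : f d = f d' :=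
  invariant_of_sameCycle hf (ℓ.sameCycle d d' h)

theorem inv_eq (d : V × Fin 3) : ℓ.L (C.inv d) = ℓ.L (d.1, turn (σ d.1) d.2) := by
  rw [← ℓ.face_eq (C.inv d), C.face_inv]

theorem inv_turn_eq (v : V) (t : Fin 3) :
    ℓ.L (C.inv (v, turn (!σ v) t)) = ℓ.L (v, t) := by
  rw [ℓ.inv_eq, turn_turn_not]

theorem sameFace_iff (d d' : V × Fin 3) :
    (C.rot σ).SameFace (C.dart d) (C.dart d') ↔ ℓ.L d = ℓ.L d' := by
  rw [C.sameFace_iff, ℓ.eq_iff]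

theorem Good.inv_ne {ℓ : C.Labelling σ Λ} (h : ℓ.Good) (d : V × Fin 3) :
    ℓ.L (C.inv d) ≠ ℓ.L d := by
  rw [ℓ.inv_eq]
  intro h'
  exact turn_ne _ _ (h.vertex d.1 _ _ h')

/-- Two faces with a common vertex have a common edge there, as the vertices have degree three. -/
theorem exists_common_dart {v : V} {s t : Fin 3} (hne : ℓ.L (v, s) ≠ ℓ.L (v, t)) :
    ∃ e, ℓ.L e = ℓ.L (v, s) ∧ ℓ.L (C.inv e) = ℓ.L (v, t) ∧ (v = e.1 ∨ v = (C.inv e).1) := by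
  rcases eq_turn (σ v) s t with rfl | rfl | rfl
  · exact absurd rfl hne
  · exact ⟨(v, s), rfl, ℓ.inv_eq _, Or.inl rfl⟩
  · refine ⟨C.inv (v, t), ℓ.inv_eq _, ?_, Or.inr ?_⟩ <;> rw [C.inv_inv]

theorem mem_faceVerts {d : V × Fin 3} {v : V} :
    v ∈ (C.rot σ).faceVerts (C.dart d) ↔ ∃ t, ℓ.L d = ℓ.L (v, t) := by
  constructor
  · rintro ⟨d', h, rfl⟩
    obtain ⟨⟨w, t⟩, rfl⟩ := C.dart_bijective.2 d'
    exact ⟨t, (ℓ.sameFace_iff _ _).1 h⟩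
  · rintro ⟨t, h⟩
    exact ⟨C.dart (v, t), (ℓ.sameFace_iff _ _).2 h, rfl⟩

theorem mem_faceEdges {d : V × Fin 3} {x : Sym2 V} :
    x ∈ (C.rot σ).faceEdges (C.dart d) ↔ ∃ e, ℓ.L d = ℓ.L e ∧ (C.dart e).edge = x := by
  constructor
  · rintro ⟨d', h, rfl⟩
    obtain ⟨e, rfl⟩ := C.dart_bijective.2 d'
    exact ⟨e, (ℓ.sameFace_iff _ _).1 h, rfl⟩
  · rintro ⟨e, h, rfl⟩
    exact ⟨C.dart e, (ℓ.sameFace_iff _ _).2 h, rfl⟩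

theorem edge_eq_iff {d e : V × Fin 3} :
    (C.dart d).edge = (C.dart e).edge ↔ d = e ∨ d = C.inv e := by
  rw [SimpleGraph.dart_edge_eq_iff, ← C.dart_inv, C.dart_bijective.1.eq_iff,
    C.dart_bijective.1.eq_iff]

theorem Good.isPolyhedral {ℓ : C.Labelling σ Λ} (h : ℓ.Good) : (C.rot σ).IsPolyhedral where
  vertex_simple d d' := by
    obtain ⟨⟨v, s⟩, rfl⟩ := C.dart_bijective.2 d
    obtain ⟨⟨w, t⟩, rfl⟩ := C.dart_bijective.2 d'
    intro hf hv
    obtain rfl : v = w := hv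
    rw [h.vertex v s t ((ℓ.sameFace_iff _ _).1 hf)]
  edge_simple d := by
    obtain ⟨d, rfl⟩ := C.dart_bijective.2 d
    rw [← C.dart_inv, ℓ.sameFace_iff]
    exact fun h' => h.inv_ne d h'.symm
  inter d d' := by
    obtain ⟨d, rfl⟩ := C.dart_bijective.2 d
    obtain ⟨d', rfl⟩ := C.dart_bijective.2 d'
    rw [ℓ.sameFace_iff]
    intro hne
    by_cases he : ∃ e, ℓ.L e = ℓ.L d ∧ ℓ.L (C.inv e) = ℓ.L d'
    · obtain ⟨e, he, he'⟩ := he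
      refine Or.inr (Or.inr ⟨e.1, (C.inv e).1, ?_, ?_⟩)
      · ext v
        simp only [Set.mem_inter_iff, ℓ.mem_faceVerts, Set.mem_insert_iff, Set.mem_singleton_iff]
        constructor
        · rintro ⟨⟨s, hs⟩, t, ht⟩
          obtain ⟨e1, h1, h2, h3⟩ := ℓ.exists_common_dart (v := v) (s := s) (t := t)
            (by rw [← hs, ← ht]; exact hne)
          obtain rfl : e1 = e := h.edge _ _ (by rw [h1, ← hs, he]) (by rw [h2, ← ht, he'])
          exact h3
        · rintro (rfl | rfl)
          · exact ⟨⟨e.2, he.symm⟩, _, he'.symm.trans (ℓ.inv_eq e)⟩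
          · refine ⟨⟨turn (σ (C.inv e).1) (C.inv e).2, ?_⟩, (C.inv e).2, he'.symm⟩
            rw [← ℓ.inv_eq, C.inv_inv, he]
      · ext x
        simp only [Set.mem_inter_iff, ℓ.mem_faceEdges, Set.mem_singleton_iff]
        constructor
        · rintro ⟨⟨e1, h1, rfl⟩, e2, h2, h3⟩
          rcases edge_eq_iff.1 h3 with rfl | rfl
          · exact absurd (h1.trans h2.symm) hne
          · obtain rfl : e1 = e := h.edge _ _ (by rw [← h1, he]) (by rw [← h2, he'])
            rfl
        · rintro rfl
          exact ⟨⟨e, he.symm, rfl⟩, C.inv e, he'.symm, edge_eq_iff.2 (Or.inr rfl)⟩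
    · refine Or.inl ⟨?_, ?_⟩
      · ext v
        simp only [Set.mem_inter_iff, ℓ.mem_faceVerts, Set.mem_empty_iff_false, iff_false]
        rintro ⟨⟨s, hs⟩, t, ht⟩
        obtain ⟨e1, h1, h2, -⟩ := ℓ.exists_common_dart (v := v) (s := s) (t := t)
          (by rw [← hs, ← ht]; exact hne)
        exact he ⟨e1, by rw [h1, ← hs], by rw [h2, ← ht]⟩
      · ext x
        simp only [Set.mem_inter_iff, ℓ.mem_faceEdges, Set.mem_empty_iff_false, iff_false]
        rintro ⟨⟨e1, h1, rfl⟩, e2, h2, h3⟩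
        rcases edge_eq_iff.1 h3 with rfl | rfl
        · exact hne (h1.trans h2.symm)
        · exact he ⟨e1, h1.symm, h2.symm⟩

theorem good_of_isPolyhedral (h : (C.rot σ).IsPolyhedral) : ℓ.Good where
  vertex v s t hst := by
    have := h.vertex_simple (C.dart (v, s)) (C.dart (v, t)) ((ℓ.sameFace_iff _ _).2 hst) rfl
    exact (Prod.mk.inj (C.dart_bijective.1 this)).2
  edge d d' h1 h2 := by
    have hn : ∀ d, ℓ.L d ≠ ℓ.L (C.inv d) := fun d h' =>
      h.edge_simple (C.dart d) (by rw [← C.dart_inv, ℓ.sameFace_iff]; exact h')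
    have hne : ¬ (C.rot σ).SameFace (C.dart d) (C.dart (C.inv d)) := by
      rw [ℓ.sameFace_iff]; exact hn d
    have m1 : (C.dart d).edge ∈ (C.rot σ).faceEdges (C.dart d) ∩
        (C.rot σ).faceEdges (C.dart (C.inv d)) :=
      ⟨ℓ.mem_faceEdges.2 ⟨d, rfl, rfl⟩,
        ℓ.mem_faceEdges.2 ⟨C.inv d, rfl, edge_eq_iff.2 (Or.inr rfl)⟩⟩
    have m2 : (C.dart d').edge ∈ (C.rot σ).faceEdges (C.dart d) ∩
        (C.rot σ).faceEdges (C.dart (C.inv d)) :=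
      ⟨ℓ.mem_faceEdges.2 ⟨d', h1, rfl⟩,
        ℓ.mem_faceEdges.2 ⟨C.inv d', h2, edge_eq_iff.2 (Or.inr rfl)⟩⟩
    rcases h.inter _ _ hne with ⟨-, h0⟩ | ⟨v, -, h0⟩ | ⟨u, v, -, h0⟩
    · rw [h0] at m1; exact m1.elim
    · rw [h0] at m1; exact m1.elim
    · rw [h0, Set.mem_singleton_iff] at m1 m2
      rcases edge_eq_iff.1 (m1.trans m2.symm) with h3 | h3
      · exact h3
      · rw [h3] at h1
        exact absurd h1.symm (hn d')

theorem isPolyhedral_iff : (C.rot σ).IsPolyhedral ↔ ℓ.Good :=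
  ⟨ℓ.good_of_isPolyhedral, Good.isPolyhedral⟩

theorem card_face (ℓ : C.Labelling σ Λ) : Nat.card (C.rot σ).Face = Nat.card Λ := by
  refine Nat.card_congr (Equiv.ofBijective
    (Quotient.lift (fun d => ℓ.L (C.dartEquiv.symm d)) ?_) ⟨?_, ?_⟩)
  · intro d d' h
    obtain ⟨d, rfl⟩ := C.dartEquiv.surjective d
    obtain ⟨d', rfl⟩ := C.dartEquiv.surjective d'
    simpa using (ℓ.sameFace_iff d d').1 h
  · intro x y
    induction x using Quotient.inductionOn with | _ d
    induction y using Quotient.inductionOn with | _ d'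
    obtain ⟨d, rfl⟩ := C.dartEquiv.surjective d
    obtain ⟨d', rfl⟩ := C.dartEquiv.surjective d'
    intro h
    refine Quotient.sound ((ℓ.sameFace_iff _ _).2 ?_)
    simpa using h
  · intro a
    obtain ⟨d, rfl⟩ := ℓ.surj a
    exact ⟨Quotient.mk _ (C.dartEquiv d), by simp⟩

theorem _root_.CubicData.two_mul_card_edgeSet [Finite V] (C : CubicData V) :
    2 * Nat.card C.graph.edgeSet = 3 * Nat.card V := by
  classical
  have := Fintype.ofFinite V
  have h := C.graph.dart_card_eq_twice_card_edges
  rw [← Fintype.card_congr C.dartEquiv, Fintype.card_prod, Fintype.card_fin,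
    SimpleGraph.edgeFinset_card] at h
  rw [Nat.card_eq_fintype_card, Nat.card_eq_fintype_card]
  omega

/-- Euler's formula for a cubic graph, which has `3 * |V| / 2` edges. -/
theorem hasGenus_iff [Finite V] (ℓ : C.Labelling σ Λ) (g : ℕ) :
    (C.rot σ).HasGenus g ↔ 2 * Nat.card Λ + 4 * g = Nat.card V + 4 := by
  have h := C.two_mul_card_edgeSet
  rw [RotationSystem.HasGenus, ℓ.card_face]
  omega

variable (C σ) in
/-- The labelling by the orbits themselves. -/
def ofFace : C.Labelling σ (Quotient (Equiv.Perm.SameCycle.setoid (C.face σ))) where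
  L := Quotient.mk _
  face_eq _ := Quotient.sound (Equiv.Perm.sameCycle_apply_left.2 (Equiv.Perm.SameCycle.refl _ _))
  sameCycle _ _ h := Quotient.exact h
  surj := Quotient.mk_surjective

/-- The mirror image has the same faces, traversed backwards: a dart gets the label of its
reversal. -/
def mirror : C.Labelling (fun v => !σ v) Λ where
  L d := ℓ.L (C.inv d)
  face_eq d := by
    rw [C.face_apply, ℓ.inv_turn_eq]
  sameCycle d d' h := by
    have hf : ∀ d, (C.face (fun v => !σ v)).SameCycle (C.inv (C.face σ d)) (C.inv d) := by
      intro d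
      refine ⟨1, ?_⟩
      rw [zpow_one, C.face_inv, face_apply]
      exact Prod.ext rfl (turn_not_turn _ _)
    have := ℓ.invariant (f := fun e => (⟦C.inv e⟧ : Quotient
      (Equiv.Perm.SameCycle.setoid (C.face (fun v => !σ v))))) (fun d => Quotient.sound (hf d)) h
    simp only [C.inv_inv] at this
    exact Quotient.exact this
  surj a := by
    obtain ⟨d, rfl⟩ := ℓ.surj a
    exact ⟨C.inv d, congrArg ℓ.L (C.inv_inv d)⟩

theorem Good.mirror {ℓ : C.Labelling σ Λ} (h : ℓ.Good) : ℓ.mirror.Good where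
  vertex v s t hst := by
    have h1 : ℓ.L (C.inv (v, s)) = ℓ.L (C.inv (v, t)) := hst
    rw [ℓ.inv_eq, ℓ.inv_eq] at h1
    have h2 := h.vertex _ _ _ h1
    have := congrArg (turn (!σ v)) h2
    simpa [turn_not_turn] using this
  edge d d' h1 h2 := by
    refine h.edge _ _ ?_ h1
    have h2' : ℓ.L (C.inv (C.inv d)) = ℓ.L (C.inv (C.inv d')) := h2
    simpa [C.inv_inv] using h2'

end Labelling

variable (C) in
theorem isCubicGraph [Finite V] (h : C.graph.Connected) : IsCubicGraph C.graph where
  finite := inferInstance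
  connected := h
  degree_eq_three v := by
    have : C.graph.neighborSet v = Set.range (fun t => (C.inv (v, t)).1) := rfl
    rw [this, ← Set.image_univ, Set.ncard_image_of_injective _ fun s t h => C.inj v s t h,
      Set.ncard_univ, Nat.card_fin]

variable (C) in
/-- The orientations `σ` give a polyhedral embedding of genus `g`. -/
def PolyGenus (σ : V → Bool) (g : ℕ) : Prop :=
  (C.rot σ).IsPolyhedral ∧ (C.rot σ).HasGenus g

theorem PolyGenus.mirror [Finite V] {σ : V → Bool} {g : ℕ} (h : C.PolyGenus σ g) :
    C.PolyGenus (fun v => !σ v) g := by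
  let ℓ := Labelling.ofFace C σ
  exact ⟨(ℓ.isPolyhedral_iff.1 h.1).mirror.isPolyhedral,
    (ℓ.mirror.hasGenus_iff g).2 ((ℓ.hasGenus_iff g).1 h.2)⟩

/-! ### Star products -/

/-- A graph is connected if all functions that are constant along its edges are constant. -/
theorem connected_of_forall {V : Type*} {C : CubicData V} [Nonempty V]
    (h : ∀ f : V → Prop, (∀ d : V × Fin 3, f (C.inv d).1 = f d.1) → ∀ u v, f u = f v) :
    C.graph.Connected := by
  refine { preconnected := fun u v => ?_, nonempty := inferInstance }
  have := h (fun x => C.graph.Reachable u x) (fun d => propext ?_) u v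
  · exact this ▸ SimpleGraph.Reachable.refl u
  · have ha : C.graph.Adj d.1 (C.inv d).1 := ⟨d.2, rfl⟩
    exact ⟨fun h => h.trans ha.symm.reachable, fun h => h.trans ha.reachable⟩

theorem eq_of_connected {V X : Type*} {C : CubicData V} (hC : C.graph.Connected) {f : V → X}
    (h : ∀ d : V × Fin 3, f (C.inv d).1 = f d.1) (u v : V) : f u = f v := by
  obtain ⟨p⟩ := hC.preconnected u v
  induction p with
  | nil => rfl
  | cons ha _ ih =>
    obtain ⟨t, rfl⟩ := ha
    rw [← ih]
    exact (h (_, t)).symm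

/-- A function that is invariant under `p` along the cycle of `a`, except for the steps from and to
`a`, takes the same value at both ends of this path. -/
theorem apply_eq_apply_inv_of_path {α X : Type*} [Finite α] (p : Equiv.Perm α) (a : α) (f : α → X)
    (hp : p a ≠ a) (hf : ∀ b, p.SameCycle a b → b ≠ a → p b ≠ a → f (p b) = f b) :
    f (p a) = f (p.symm a) := by
  have hex : ∃ k, 0 < k ∧ (p ^ k) a = a :=
    ⟨orderOf p, (isOfFinOrder_of_finite p).orderOf_pos, by rw [pow_orderOf_eq_one]; rfl⟩
  classical
  obtain ⟨hk, hka⟩ := Nat.find_spec hex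
  set k := Nat.find hex with hkdef
  have hmin : ∀ j, 0 < j → j < k → (p ^ j) a ≠ a := fun j h0 hj h =>
    Nat.find_min hex hj ⟨h0, h⟩
  have hstep : ∀ j, j + 1 < k → f ((p ^ (j + 1)) a) = f (p a) := by
    intro j
    induction j with
    | zero => intro _; rfl
    | succ j ih =>
      intro hj
      rw [← ih (by omega), pow_succ' p (j + 1), Equiv.Perm.mul_apply]
      refine hf _ ⟨(j + 1 : ℕ), by rw [zpow_natCast]⟩ (hmin _ (by omega) (by omega)) ?_
      rw [← Equiv.Perm.mul_apply, ← pow_succ']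
      exact hmin _ (by omega) hj
  have hk2 : k ≠ 1 := by
    intro h
    rw [h, pow_one] at hka
    exact hp hka
  obtain ⟨j, hj⟩ : ∃ j, k = j + 1 + 1 := ⟨k - 2, by omega⟩
  rw [← hstep j (by omega)]
  congr 1
  rw [Equiv.eq_symm_apply, ← Equiv.Perm.mul_apply, ← pow_succ', ← hj, hka]

theorem inv_fst_ne {V : Type*} (C : CubicData V) (v : V) (t : Fin 3) : (C.inv (v, t)).1 ≠ v :=
  C.fst_ne (v, t)

theorem face_fst_ne {V : Type*} (C : CubicData V) (σ : V → Bool) (v : V) (t : Fin 3) :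
    (C.face σ (v, t)).1 ≠ v := C.fst_ne (v, t)

section Star

variable {V W : Type*} (K : CubicData V) (w : V) (G : CubicData W) (v : W)

/-- The vertices of the star product: those of the two factors except for `w` and `v`. -/
abbrev StarVertex (w : V) (v : W) : Type _ := {x : V // x ≠ w} ⊕ {y : W // y ≠ v}

variable {w v} in
/-- A dart of the first factor as a dart of the star product. -/
def left (d : V × Fin 3) (h : d.1 ≠ w) : StarVertex w v × Fin 3 := (Sum.inl ⟨d.1, h⟩, d.2)

variable {w v} in
/-- A dart of the second factor as a dart of the star product. -/
def right (d : W × Fin 3) (h : d.1 ≠ v) : StarVertex w v × Fin 3 := (Sum.inr ⟨d.1, h⟩, d.2)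

open Classical in
/-- The reversal of darts in the star product: the neighbour `t` of `w` is joined to the neighbour
`-t` of `v`. -/
noncomputable def starInv : StarVertex w v × Fin 3 → StarVertex w v × Fin 3
  | (Sum.inl x, t) =>
    if h : (K.inv (x.1, t)).1 = w then right (G.inv (v, -(K.inv (x.1, t)).2)) (G.fst_ne _)
    else left (K.inv (x.1, t)) h
  | (Sum.inr y, t) =>
    if h : (G.inv (y.1, t)).1 = v then left (K.inv (w, -(G.inv (y.1, t)).2)) (K.fst_ne _)
    else right (G.inv (y.1, t)) h

theorem starInv_left {d : V × Fin 3} (h : d.1 ≠ w) (h' : (K.inv d).1 ≠ w) :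
    starInv K w G v (left d h) = left (K.inv d) h' := by
  simp only [starInv, left]
  exact dif_neg h'

theorem starInv_right {d : W × Fin 3} (h : d.1 ≠ v) (h' : (G.inv d).1 ≠ v) :
    starInv K w G v (right d h) = right (G.inv d) h' := by
  simp only [starInv, right]
  exact dif_neg h'

theorem starInv_left_port (t : Fin 3) :
    starInv K w G v (left (K.inv (w, t)) (K.inv_fst_ne _ _)) =
      right (G.inv (v, -t)) (G.inv_fst_ne _ _) := by
  simp only [starInv, left, Prod.mk.eta, K.inv_inv]
  simp

theorem starInv_right_port (t : Fin 3) :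
    starInv K w G v (right (G.inv (v, t)) (G.inv_fst_ne _ _)) =
      left (K.inv (w, -t)) (K.inv_fst_ne _ _) := by
  simp only [starInv, right, Prod.mk.eta, G.inv_inv]
  simp

theorem eq_port {C : CubicData V} {d : V × Fin 3} {w : V} (h : (C.inv d).1 = w) :
    d = C.inv (w, (C.inv d).2) := by
  rw [← h, Prod.mk.eta, C.inv_inv]

/-- The four kinds of darts of a star product. -/
theorem star_cases {P : StarVertex w v × Fin 3 → Prop}
    (left : ∀ d h, (K.inv d).1 ≠ w → P (left d h))
    (leftPort : ∀ t, P (CubicData.left (K.inv (w, t)) (K.inv_fst_ne _ _)))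
    (right : ∀ d h, (G.inv d).1 ≠ v → P (right d h))
    (rightPort : ∀ t, P (CubicData.right (G.inv (v, t)) (G.inv_fst_ne _ _))) (e) : P e := by
  obtain ⟨⟨x, hx⟩ | ⟨y, hy⟩, t⟩ := e
  · by_cases h : (K.inv (x, t)).1 = w
    · have h1 := leftPort (K.inv (x, t)).2
      have h2 := eq_port h
      simp only [← h2] at h1
      exact h1
    · exact left (x, t) hx h
  · by_cases h : (G.inv (y, t)).1 = v
    · have h1 := rightPort (G.inv (y, t)).2
      have h2 := eq_port h
      simp only [← h2] at h1
      exact h1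
    · exact right (y, t) hy h

theorem left_fst_inj {d d' : V × Fin 3} {h : d.1 ≠ w} {h' : d'.1 ≠ w}
    (he : (left d h : StarVertex w v × Fin 3).1 = (left d' h').1) : d.1 = d'.1 := by
  simpa [left] using he

theorem right_fst_inj {d d' : W × Fin 3} {h : d.1 ≠ v} {h' : d'.1 ≠ v}
    (he : (right d h : StarVertex w v × Fin 3).1 = (right d' h').1) : d.1 = d'.1 := by
  simpa [right] using he

/-- The star product: `w` and `v` are deleted, and their neighbours are joined. Matching the number
`t` with `-t` reverses the cyclic orders, as is needed for embeddings that have the same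
orientation at `w` and at `v`. -/
noncomputable def star : CubicData (StarVertex w v) where
  inv := starInv K w G v
  inv_inv := by
    refine star_cases K w G v ?_ ?_ ?_ ?_
    · intro d h h'
      rw [starInv_left K w G v h h',
        starInv_left K w G v h' (by rw [K.inv_inv]; exact h)]
      simp only [K.inv_inv]
    · intro t
      rw [starInv_left_port, starInv_right_port]
      simp only [neg_neg]
    · intro d h h'
      rw [starInv_right K w G v h h',
        starInv_right K w G v h' (by rw [G.inv_inv]; exact h)]
      simp only [G.inv_inv]
    · intro t
      rw [starInv_right_port, starInv_left_port]
      simp only [neg_neg]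
  fst_ne := by
    refine star_cases K w G v ?_ ?_ ?_ ?_
    · intro d h h' he
      rw [starInv_left K w G v h h'] at he
      exact K.fst_ne d (left_fst_inj w v he)
    · intro t
      rw [starInv_left_port]
      exact Sum.inr_ne_inl
    · intro d h h' he
      rw [starInv_right K w G v h h'] at he
      exact G.fst_ne d (right_fst_inj w v he)
    · intro t
      rw [starInv_right_port]
      exact Sum.inl_ne_inr
  inj := by
    rintro (⟨x, hx⟩ | ⟨x, hx⟩) s t h
    · simp only [starInv] at h
      refine K.inj x s t ?_
      split_ifs at h with h1 h2 h2
      · rw [h1, h2]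
      · exact absurd h Sum.inr_ne_inl
      · exact absurd h Sum.inl_ne_inr
      · exact left_fst_inj w v h
    · simp only [starInv] at h
      refine G.inj x s t ?_
      split_ifs at h with h1 h2 h2
      · rw [h1, h2]
      · exact absurd h Sum.inl_ne_inr
      · exact absurd h Sum.inr_ne_inl
      · exact right_fst_inj w v h

theorem star_inv_left {d : V × Fin 3} (h : d.1 ≠ w) (h' : (K.inv d).1 ≠ w) :
    (star K w G v).inv (left d h) = left (K.inv d) h' := starInv_left K w G v h h'

theorem star_inv_right {d : W × Fin 3} (h : d.1 ≠ v) (h' : (G.inv d).1 ≠ v) :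
    (star K w G v).inv (right d h) = right (G.inv d) h' := starInv_right K w G v h h'

theorem star_inv_left_port (t : Fin 3) :
    (star K w G v).inv (left (K.inv (w, t)) (K.inv_fst_ne _ _)) =
      right (G.inv (v, -t)) (G.inv_fst_ne _ _) := starInv_left_port K w G v t

theorem star_inv_right_port (t : Fin 3) :
    (star K w G v).inv (right (G.inv (v, t)) (G.inv_fst_ne _ _)) =
      left (K.inv (w, -t)) (K.inv_fst_ne _ _) := starInv_right_port K w G v t

variable {w v} in
/-- Orientations of the star product from orientations of the factors. -/
def starSign (σ : V → Bool) (τ : W → Bool) : StarVertex w v → Bool :=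
  Sum.elim (fun x => σ x.1) (fun y => τ y.1)

variable (σ : V → Bool) (τ : W → Bool)

theorem star_face_left {d : V × Fin 3} (h : d.1 ≠ w) (h' : (K.inv d).1 ≠ w) :
    (star K w G v).face (starSign σ τ) (left d h) = left (K.face σ d) h' := by
  rw [face_apply, star_inv_left K w G v h h']
  rfl

theorem star_face_right {d : W × Fin 3} (h : d.1 ≠ v) (h' : (G.inv d).1 ≠ v) :
    (star K w G v).face (starSign σ τ) (right d h) = right (G.face τ d) h' := by
  rw [face_apply, star_inv_right K w G v h h']
  rfl

theorem star_face_left_port (t : Fin 3) :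
    (star K w G v).face (starSign σ τ) (left (K.inv (w, t)) (K.inv_fst_ne _ _)) =
      right (G.face τ (v, -t)) (G.face_fst_ne _ _ _) := by
  rw [face_apply, star_inv_left_port]
  rfl

theorem star_face_right_port (t : Fin 3) :
    (star K w G v).face (starSign σ τ) (right (G.inv (v, t)) (G.inv_fst_ne _ _)) =
      left (K.face σ (w, -t)) (K.face_fst_ne _ _ _) := by
  rw [face_apply, star_inv_right_port]
  rfl

theorem turn_neg (b : Bool) (t : Fin 3) : turn b (-t) = -turn (!b) t := by
  revert b t; decide

theorem face_symm_apply (C : CubicData V) (v : V) (t : Fin 3) :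
    (C.face σ).symm (v, t) = C.inv (v, turn (!σ v) t) := by
  rw [Equiv.symm_apply_eq, C.face_inv, turn_turn_not]

/-- A face that enters the second factor leaves it along the next new edge, having followed a face
at `v` all the way round. It visits `v` only once, by polyhedrality. -/
theorem star_path [Finite W] {M X : Type*} (m : G.Labelling τ M) (hm : m.Good)
    {f : StarVertex w v × Fin 3 → X} (hf : ∀ e, f ((star K w G v).face (starSign σ τ) e) = f e)
    (t : Fin 3) :
    f (left (K.inv (w, t)) (K.inv_fst_ne _ _)) =
      f (left (K.face σ (w, turn (τ v) t)) (K.face_fst_ne _ _ _)) := by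
  classical
  let h : W × Fin 3 → X := fun e =>
    if he : e.1 ≠ v then f (right e he) else f (right (G.inv (v, 0)) (G.inv_fst_ne _ _))
  have hr : ∀ e (he : e.1 ≠ v), h e = f (right e he) := fun e he => dif_pos he
  have key := apply_eq_apply_inv_of_path (G.face τ) (v, -t) h ?_ ?_
  · rw [hr _ (G.fst_ne _), face_symm_apply, hr _ (G.fst_ne _),
      ← hf (right (G.inv _) _), star_face_right_port] at key
    rw [← hf (left (K.inv _) _), star_face_left_port, key]
    simp only [turn_neg, neg_neg, Bool.not_not]
  · intro he
    exact G.face_fst_ne τ v (-t) (congrArg Prod.fst he)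
  · intro b hb hne hne'
    have h1 : b.1 ≠ v := by
      intro h1
      refine hne (Prod.ext h1 ?_)
      obtain ⟨b1, b2⟩ := b
      obtain rfl : b1 = v := h1
      exact hm.vertex b1 _ _ (m.eq_iff _ _ |>.2 hb.symm)
    have h2 : (G.inv b).1 ≠ v := by
      intro h2
      refine hne' ?_
      have h3 := m.face_eq b
      rw [← m.eq_iff] at hb
      have h4 : G.face τ b = (v, (G.face τ b).2) := Prod.ext h2 rfl
      rw [h4] at h3 ⊢
      rw [hm.vertex v _ _ (h3.trans hb.symm)]
    rw [hr b h1, hr (G.face τ b) h2, ← star_face_right K w G v σ τ h1 h2, hf]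

theorem star_swap (e : StarVertex w v × Fin 3) :
    (star G v K w).inv (e.1.swap, e.2) =
      (((star K w G v).inv e).1.swap, ((star K w G v).inv e).2) := by
  revert e
  refine star_cases K w G v ?_ ?_ ?_ ?_
  · intro d h h'
    rw [star_inv_left K w G v h h']
    exact star_inv_right G v K w h h'
  · intro t
    rw [star_inv_left_port]
    exact star_inv_right_port G v K w t
  · intro d h h'
    rw [star_inv_right K w G v h h']
    exact star_inv_left G v K w h h'
  · intro t
    rw [star_inv_right_port]
    exact star_inv_left_port G v K w t

/-- The counterpart of `star_path` for a face that enters the first factor. -/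
theorem star_path' [Finite V] {Λ X : Type*} (ℓ : K.Labelling σ Λ) (hℓ : ℓ.Good)
    {f : StarVertex w v × Fin 3 → X} (hf : ∀ e, f ((star K w G v).face (starSign σ τ) e) = f e)
    (t : Fin 3) :
    f (right (G.inv (v, t)) (G.inv_fst_ne _ _)) =
      f (right (G.face τ (v, turn (σ w) t)) (G.face_fst_ne _ _ _)) := by
  refine star_path G v K w τ σ ℓ hℓ (f := fun e => f (e.1.swap, e.2)) (fun e => ?_) t
  rw [← hf (e.1.swap, e.2), face_apply, face_apply, star_swap]
  congr 2
  simp only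
  rcases ((star G v K w).inv e).1 with _ | _ <;> rfl

variable {K w G v σ τ} {Λ M : Type*}

/-- A function that is constant along the faces of the star product comes from such a function on
the first factor. -/
theorem star_invariant_left [Finite W] (m : G.Labelling τ M) (hm : m.Good) (hb : σ w = τ v)
    {X : Type*} {f : StarVertex w v × Fin 3 → X}
    (hf : ∀ e, f ((star K w G v).face (starSign σ τ) e) = f e) :
    ∃ fK : V × Fin 3 → X, (∀ d, fK (K.face σ d) = fK d) ∧
      (∀ d h, fK d = f (left d h)) ∧
      ∀ t, fK (w, t) = f (left (K.face σ (w, t)) (K.face_fst_ne _ _ _)) := by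
  classical
  let fK : V × Fin 3 → X := fun d =>
    if h : d.1 ≠ w then f (left d h) else f (left (K.face σ (w, d.2)) (K.face_fst_ne _ _ _))
  have h1 : ∀ d h, fK d = f (left d h) := fun d h => dif_pos h
  have h2 : ∀ t, fK (w, t) = f (left (K.face σ (w, t)) (K.face_fst_ne _ _ _)) :=
    fun t => dif_neg (by simp)
  refine ⟨fK, fun d => ?_, h1, h2⟩
  by_cases hd : d.1 = w
  · obtain ⟨x, t⟩ := d
    obtain rfl : x = w := hd
    rw [h1 _ (K.fst_ne _), h2]
  · by_cases hd' : (K.inv d).1 = w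
    · rw [eq_port hd', K.face_inv, h2, h1 _ (K.fst_ne _), star_path K w G v σ τ m hm hf, hb]
    · rw [h1 _ hd, h1 (K.face σ d) hd', ← star_face_left K w G v σ τ hd hd', hf]

/-- A function that is constant along the faces of the star product comes from such a function on
the second factor. -/
theorem star_invariant_right [Finite V] (ℓ : K.Labelling σ Λ) (hℓ : ℓ.Good) (hb : σ w = τ v)
    {X : Type*} {f : StarVertex w v × Fin 3 → X}
    (hf : ∀ e, f ((star K w G v).face (starSign σ τ) e) = f e) :
    ∃ fG : W × Fin 3 → X, (∀ d, fG (G.face τ d) = fG d) ∧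
      (∀ d h, fG d = f (right d h)) ∧
      ∀ t, fG (v, t) = f (right (G.face τ (v, t)) (G.face_fst_ne _ _ _)) := by
  classical
  let fG : W × Fin 3 → X := fun d =>
    if h : d.1 ≠ v then f (right d h) else f (right (G.face τ (v, d.2)) (G.face_fst_ne _ _ _))
  have h1 : ∀ d h, fG d = f (right d h) := fun d h => dif_pos h
  have h2 : ∀ t, fG (v, t) = f (right (G.face τ (v, t)) (G.face_fst_ne _ _ _)) :=
    fun t => dif_neg (by simp)
  refine ⟨fG, fun d => ?_, h1, h2⟩
  by_cases hd : d.1 = v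
  · obtain ⟨x, t⟩ := d
    obtain rfl : x = v := hd
    rw [h1 _ (G.fst_ne _), h2]
  · by_cases hd' : (G.inv d).1 = v
    · rw [eq_port hd', G.face_inv, h2, h1 _ (G.fst_ne _), star_path' K w G v σ τ ℓ hℓ hf, hb]
    · rw [h1 _ hd, h1 (G.face τ d) hd', ← star_face_right K w G v σ τ hd hd', hf]

open Classical in
/-- The labels of the star product: the faces of the first factor, and those of the second factor
which do not contain `v`. A dart on a face at `v` gets the label of the face at `w` that continues
it. -/
noncomputable def starLabel (ℓ : K.Labelling σ Λ) (m : G.Labelling τ M) :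
    StarVertex w v × Fin 3 → Λ ⊕ {a : M // ∀ t, m.L (v, t) ≠ a}
  | (Sum.inl x, t) => Sum.inl (ℓ.L (x.1, t))
  | (Sum.inr y, t) =>
    if h : ∃ s, m.L (v, s) = m.L (y.1, t) then Sum.inl (ℓ.L (w, turn (σ w) (-h.choose)))
    else Sum.inr ⟨m.L (y.1, t), not_exists.1 h⟩

variable {ℓ : K.Labelling σ Λ} {m : G.Labelling τ M}

theorem starLabel_left (d h) :
    (starLabel ℓ m (left d h : StarVertex w v × Fin 3)) = Sum.inl (ℓ.L d) := rfl

theorem starLabel_right_of_eq (hm : m.Good) {d} (h) {s : Fin 3} (hs : m.L d = m.L (v, s)) :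
    (starLabel ℓ m (right d h : StarVertex w v × Fin 3)) =
      Sum.inl (ℓ.L (w, turn (σ w) (-s))) := by
  have hex : ∃ s, m.L (v, s) = m.L d := ⟨s, hs.symm⟩
  have h1 : hex.choose = s := hm.vertex v _ _ (hex.choose_spec.trans hs)
  simp only [right, starLabel]
  rw [dif_pos hex, h1]

theorem starLabel_right_of_ne {d} (h) (hs : ∀ s, m.L (v, s) ≠ m.L d) :
    (starLabel ℓ m (right d h : StarVertex w v × Fin 3)) = Sum.inr ⟨m.L d, hs⟩ := by
  simp only [right, starLabel]
  exact dif_neg (not_exists.2 hs)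

theorem starLabel_right_congr (hm : m.Good) {d d'} (h h') (hd : m.L d = m.L d') :
    starLabel (w := w) (v := v) ℓ m (right d h) =
      starLabel (w := w) (v := v) ℓ m (right d' h') := by
  by_cases hs : ∃ s, m.L d = m.L (v, s)
  · obtain ⟨s, hs⟩ := hs
    rw [starLabel_right_of_eq hm h hs, starLabel_right_of_eq hm h' (hd.symm.trans hs)]
  · push Not at hs
    rw [starLabel_right_of_ne h fun s => (hs s).symm,
      starLabel_right_of_ne h' fun s => hd ▸ (hs s).symm]
    simp only [hd]

theorem turn_neg_inj {b : Bool} {s t : Fin 3} (h : turn b (-s) = turn b (-t)) : s = t := by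
  revert b s t; decide

theorem starLabel_right_inj (hℓ : ℓ.Good) (hm : m.Good) {d d'} {h h'}
    (hd : starLabel (w := w) (v := v) ℓ m (right d h) =
      starLabel (w := w) (v := v) ℓ m (right d' h')) :
    m.L d = m.L d' := by
  by_cases hs : ∃ s, m.L d = m.L (v, s) <;> by_cases hs' : ∃ s, m.L d' = m.L (v, s)
  · obtain ⟨s, hs⟩ := hs
    obtain ⟨s', hs'⟩ := hs'
    rw [starLabel_right_of_eq hm h hs, starLabel_right_of_eq hm h' hs', Sum.inl.injEq] at hd
    rw [hs, hs', turn_neg_inj (hℓ.vertex w _ _ hd)]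
  · obtain ⟨s, hs⟩ := hs
    push Not at hs'
    rw [starLabel_right_of_eq hm h hs, starLabel_right_of_ne h' fun s => (hs' s).symm] at hd
    exact absurd hd Sum.inl_ne_inr
  · obtain ⟨s, hs'⟩ := hs'
    push Not at hs
    rw [starLabel_right_of_eq hm h' hs', starLabel_right_of_ne h fun s => (hs s).symm] at hd
    exact absurd hd Sum.inr_ne_inl
  · push Not at hs hs'
    rw [starLabel_right_of_ne h fun s => (hs s).symm,
      starLabel_right_of_ne h' fun s => (hs' s).symm, Sum.inr.injEq] at hd
    exact congrArg Subtype.val hd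

theorem starLabel_leftPort (t : Fin 3) :
    (starLabel ℓ m (left (K.inv (w, t)) (K.inv_fst_ne _ _) : StarVertex w v × Fin 3)) =
      Sum.inl (ℓ.L (w, turn (σ w) t)) := by
  rw [starLabel_left, ℓ.inv_eq]

theorem starLabel_rightPort (hm : m.Good) (hb : σ w = τ v) (t : Fin 3) :
    (starLabel ℓ m (right (G.inv (v, t)) (G.inv_fst_ne _ _) : StarVertex w v × Fin 3)) =
      Sum.inl (ℓ.L (w, -t)) := by
  rw [starLabel_right_of_eq hm (G.fst_ne _) (m.inv_eq _), ← turn_neg_turn hb]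
where
  turn_neg_turn (hb : σ w = τ v) : turn (σ w) (-turn (τ v) t) = -t := by
    rw [hb, turn_neg, turn_not_turn]

/-- The faces of a star product of polyhedral embeddings. -/
noncomputable def starLabelling [Finite V] [Finite W] (ℓ : K.Labelling σ Λ) (m : G.Labelling τ M)
    (hℓ : ℓ.Good) (hm : m.Good) (hb : σ w = τ v) :
    (star K w G v).Labelling (starSign σ τ) (Λ ⊕ {a : M // ∀ t, m.L (v, t) ≠ a}) where
  L := starLabel ℓ m
  face_eq := by
    refine star_cases K w G v ?_ ?_ ?_ ?_
    · intro d h h'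
      rw [star_face_left K w G v σ τ h h']
      exact congrArg Sum.inl (ℓ.face_eq d)
    · intro t
      rw [star_face_left_port, starLabel_leftPort,
        starLabel_right_of_eq hm (G.face_fst_ne _ _ _) (m.face_eq _), neg_neg]
    · intro d h h'
      rw [star_face_right K w G v σ τ h h']
      exact starLabel_right_congr hm _ _ (m.face_eq _)
    · intro t
      rw [star_face_right_port, starLabel_left, ℓ.face_eq, starLabel_rightPort hm hb]
  sameCycle := by
    intro e e' hee
    -- it is enough to compare the values of invariant functions
    suffices H : ∀ f : StarVertex w v × Fin 3 → Prop,
        (∀ e, f ((star K w G v).face (starSign σ τ) e) = f e) → f e = f e' by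
      have := H (fun a => ((star K w G v).face (starSign σ τ)).SameCycle e a)
        (fun a => propext Equiv.Perm.sameCycle_apply_right)
      exact this ▸ Equiv.Perm.SameCycle.refl _ _
    intro f hf
    obtain ⟨fK, hK, hK1, hK2⟩ := star_invariant_left m hm hb hf
    obtain ⟨fG, hG, hG1, hG2⟩ := star_invariant_right ℓ hℓ hb hf
    -- the values on the faces at the deleted vertices agree
    have hport : ∀ s, fG (v, s) = fK (w, turn (σ w) (-s)) := by
      intro s
      have h1 := star_path K w G v σ τ m hm hf (-s)
      have h2 := star_face_left_port K w G v σ τ (-s)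
      rw [← hf, h2] at h1
      simp only [neg_neg] at h1
      rw [hG2, hK2, h1]
      simp only [hb]
    have hr : ∀ d h s, m.L d = m.L (v, s) → f (right d h) = fK (w, turn (σ w) (-s)) := by
      intro d h s hs
      rw [← hG1, m.invariant hG hs, hport]
    obtain ⟨⟨x, hx⟩ | ⟨x, hx⟩, s⟩ := e <;> obtain ⟨⟨y, hy⟩ | ⟨y, hy⟩, t⟩ := e'
    · have h1 : ℓ.L (x, s) = ℓ.L (y, t) := Sum.inl.inj hee
      have := ℓ.invariant hK h1
      rwa [hK1 _ hx, hK1 _ hy] at this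
    · change starLabel ℓ m (left (x, s) hx) = starLabel ℓ m (right (y, t) hy) at hee
      change f (left (x, s) hx) = f (right (y, t) hy)
      by_cases h : ∃ u, m.L (y, t) = m.L (v, u)
      · obtain ⟨u, hu⟩ := h
        rw [starLabel_right_of_eq hm hy hu] at hee
        rw [hr _ _ u hu, ← hK1, ℓ.invariant hK (Sum.inl.inj hee)]
      · push Not at h
        rw [starLabel_right_of_ne hy fun s => (h s).symm] at hee
        exact absurd hee Sum.inl_ne_inr
    · change starLabel ℓ m (right (x, s) hx) = starLabel ℓ m (left (y, t) hy) at hee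
      change f (right (x, s) hx) = f (left (y, t) hy)
      by_cases h : ∃ u, m.L (x, s) = m.L (v, u)
      · obtain ⟨u, hu⟩ := h
        rw [starLabel_right_of_eq hm hx hu] at hee
        rw [hr _ _ u hu, ← hK1, ℓ.invariant hK (Sum.inl.inj hee)]
      · push Not at h
        rw [starLabel_right_of_ne hx fun s => (h s).symm] at hee
        exact absurd hee Sum.inr_ne_inl
    · have h1 := starLabel_right_inj hℓ hm (d := (x, s)) (d' := (y, t)) (h := hx) (h' := hy) hee
      have := m.invariant hG h1
      rwa [hG1 _ hx, hG1 _ hy] at this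
  surj := by
    rintro (a | ⟨a, ha⟩)
    · obtain ⟨⟨x, t⟩, rfl⟩ := ℓ.surj a
      by_cases h : x = w
      · refine ⟨left (K.face σ (x, t)) (h ▸ K.fst_ne _), ?_⟩
        rw [starLabel_left, ℓ.face_eq]
      · exact ⟨left (x, t) h, rfl⟩
    · obtain ⟨⟨x, t⟩, rfl⟩ := m.surj a
      have h : x ≠ v := by
        rintro rfl
        exact ha t rfl
      exact ⟨right (x, t) h, starLabel_right_of_ne h ha⟩

/-- The star product is polyhedral: two faces of the second factor that meet at `v` share an edge
there, hence no other edge, so the edges from the second factor do not repeat a pair of faces from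
the first one. -/
theorem star_good [Finite V] [Finite W] (hℓ : ℓ.Good) (hm : m.Good) (hb : σ w = τ v) :
    (starLabelling ℓ m hℓ hm hb).Good where
  vertex := by
    rintro (⟨x, hx⟩ | ⟨x, hx⟩) s t h
    · exact hℓ.vertex x s t (Sum.inl.inj h)
    · exact hm.vertex x s t (starLabel_right_inj hℓ hm (d := (x, s)) (d' := (x, t)) (h := hx)
        (h' := hx) h)
  edge := by
    -- darts with an end in the first factor carry the labels of a dart of the first factor
    have key : ∀ e : StarVertex w v × Fin 3,
        (∃ d, starLabel ℓ m e = Sum.inl (ℓ.L d) ∧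
          starLabel ℓ m ((star K w G v).inv e) = Sum.inl (ℓ.L (K.inv d)) ∧
          ((∃ h, e = left d h) ∨ ∃ t, d = (w, -t) ∧ e = right (G.inv (v, t)) (G.inv_fst_ne _ _))) ∨
        ∃ d h, ∃ h' : (G.inv d).1 ≠ v, e = right d h ∧
          (star K w G v).inv e = right (G.inv d) h' := by
      refine star_cases K w G v ?_ ?_ ?_ ?_
      · intro d h h'
        refine Or.inl ⟨d, rfl, ?_, Or.inl ⟨h, rfl⟩⟩
        rw [star_inv_left K w G v h h', starLabel_left]
      · intro t
        refine Or.inl ⟨_, rfl, ?_, Or.inl ⟨_, rfl⟩⟩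
        rw [star_inv_left_port, starLabel_rightPort hm hb, neg_neg, K.inv_inv]
      · intro d h h'
        exact Or.inr ⟨d, h, h', rfl, star_inv_right K w G v h h'⟩
      · intro t
        refine Or.inl ⟨(w, -t), starLabel_rightPort hm hb t, ?_, Or.inr ⟨t, rfl, rfl⟩⟩
        rw [star_inv_right_port, starLabel_left]
    -- an edge of the second factor shares no pair of faces with one of the first factor
    have mixed : ∀ (d : W × Fin 3) (h : d.1 ≠ v) (h' : (G.inv d).1 ≠ v) (a b : Λ),
        starLabel ℓ m (right d h : StarVertex w v × Fin 3) = Sum.inl a →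
        starLabel ℓ m (right (G.inv d) h' : StarVertex w v × Fin 3) = Sum.inl b → False := by
      intro d h h' a b h1 h2
      have hport : ∀ (d : W × Fin 3) (h : d.1 ≠ v) (a : Λ),
          starLabel ℓ m (right d h : StarVertex w v × Fin 3) = Sum.inl a →
          ∃ s, m.L d = m.L (v, s) := by
        intro d h a h1
        by_contra hc
        push Not at hc
        rw [starLabel_right_of_ne h fun s => (hc s).symm] at h1
        exact absurd h1 Sum.inr_ne_inl
      obtain ⟨s, hs⟩ := hport d h a h1
      obtain ⟨t, ht⟩ := hport _ h' b h2
      have hne : m.L (v, s) ≠ m.L (v, t) := by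
        rw [← hs, ← ht]
        exact (hm.inv_ne d).symm
      obtain ⟨e, he1, he2, he3⟩ := m.exists_common_dart hne
      obtain rfl : e = d := hm.edge _ _ (he1.trans hs.symm) (he2.trans ht.symm)
      rcases he3 with h3 | h3
      · exact h h3.symm
      · exact h' h3.symm
    intro e e' h1 h2
    change starLabel ℓ m e = starLabel ℓ m e' at h1
    change starLabel ℓ m ((star K w G v).inv e) = starLabel ℓ m ((star K w G v).inv e') at h2
    rcases key e with ⟨d, a1, a2, a3⟩ | ⟨d, h, h', rfl, a2⟩ <;>
      rcases key e' with ⟨d', b1, b2, b3⟩ | ⟨d', k, k', rfl, b2⟩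
    · rw [a1, b1] at h1
      rw [a2, b2] at h2
      obtain rfl : d = d' := hℓ.edge _ _ (Sum.inl.inj h1) (Sum.inl.inj h2)
      rcases a3 with ⟨h, rfl⟩ | ⟨t, rfl, rfl⟩ <;> rcases b3 with ⟨k, rfl⟩ | ⟨s, hs, rfl⟩
      · rfl
      · exact absurd (congrArg Prod.fst hs) h
      · exact absurd rfl k
      · obtain rfl : t = s := neg_injective (congrArg Prod.snd hs)
        rfl
    · rw [b2, a2] at h2
      exact (mixed d' k k' _ _ (h1.symm.trans a1) h2.symm).elim
    · rw [b2, a2] at h2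
      exact (mixed d h h' _ _ (h1.trans b1) h2).elim
    · rw [a2, b2] at h2
      obtain rfl : d = d' := hm.edge _ _ (starLabel_right_inj hℓ hm h1)
        (starLabel_right_inj hℓ hm h2)
      rfl

theorem Labelling.finite [Finite V] (ℓ : K.Labelling σ Λ) : Finite Λ :=
  Finite.of_surjective _ ℓ.surj

theorem card_subtype_ne_add_one [Finite V] (w : V) : Nat.card {x // x ≠ w} + 1 = Nat.card V := by
  classical
  have := Fintype.ofFinite V
  have h := Fintype.card_pos_iff.2 ⟨w⟩
  simp only [Nat.card_eq_fintype_card]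
  rw [Fintype.card_subtype_compl, Fintype.card_subtype_eq]
  omega

theorem card_not_port_add_three [Finite W] (m : G.Labelling τ M) (hm : m.Good) :
    Nat.card {a : M // ∀ t, m.L (v, t) ≠ a} + 3 = Nat.card M := by
  classical
  have := m.finite
  have := Fintype.ofFinite M
  have h1 : Finset.card (Finset.univ.image fun t => m.L (v, t)) = 3 := by
    rw [Finset.card_image_of_injective _ fun s t h => hm.vertex v s t h]
    rfl
  have h2 := Finset.card_compl_add_card (Finset.univ.image fun t => m.L (v, t))
  rw [h1] at h2
  rw [Nat.card_eq_fintype_card, Nat.card_eq_fintype_card, ← h2, Fintype.card_subtype]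
  congr 2
  ext a
  simp

/-- A star product of polyhedral embeddings is polyhedral, and the genera add up. -/
theorem PolyGenus.star [Finite V] [Finite W] {g g' : ℕ} (h : K.PolyGenus σ g)
    (h' : G.PolyGenus τ g') (hb : σ w = τ v) :
    (star K w G v).PolyGenus (starSign σ τ) (g + g') := by
  let ℓ := Labelling.ofFace K σ
  let m := Labelling.ofFace G τ
  have hℓ := ℓ.good_of_isPolyhedral h.1
  have hm := m.good_of_isPolyhedral h'.1
  refine ⟨(star_good hℓ hm hb).isPolyhedral, (Labelling.hasGenus_iff
    (starLabelling ℓ m hℓ hm hb) _).2 ?_⟩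
  have := ℓ.finite
  have := m.finite
  have h1 := (ℓ.hasGenus_iff g).1 h.2
  have h2 := (m.hasGenus_iff g').1 h'.2
  have h3 := card_subtype_ne_add_one w
  have h4 := card_subtype_ne_add_one v
  have h5 := card_not_port_add_three (v := v) m hm
  rw [Nat.card_sum, Nat.card_sum]
  omega

theorem star_connected [Finite V] [Finite W] {g g' : ℕ} (h : K.PolyGenus σ g)
    (h' : G.PolyGenus τ g') (hb : σ w = τ v) (hK : K.graph.Connected) (hG : G.graph.Connected) :
    (star K w G v).graph.Connected := by
  classical
  let ℓ := Labelling.ofFace K σ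
  let m := Labelling.ofFace G τ
  have hℓ := ℓ.good_of_isPolyhedral h.1
  have hm := m.good_of_isPolyhedral h'.1
  have : Nonempty (StarVertex w v) := ⟨Sum.inl ⟨_, K.fst_ne (w, 0)⟩⟩
  refine connected_of_forall fun f hf => ?_
  -- the three edges that replace `w` and `v` lie in one component, as the faces there show
  have hface : ∀ e, f ((star K w G v).face (starSign σ τ) e).1 = f e.1 := hf
  have hturn : ∀ t, f (left (K.inv (w, t)) (K.inv_fst_ne _ _) : StarVertex w v × Fin 3).1 =
      f (left (K.inv (w, turn (τ v) t)) (K.inv_fst_ne _ _) : StarVertex w v × Fin 3).1 :=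
    fun t => star_path K w G v σ τ m hm (f := fun e => f e.1) hface t
  have hl : ∀ t, f (left (K.inv (w, t)) (K.inv_fst_ne _ _) : StarVertex w v × Fin 3).1 =
      f (left (K.inv (w, 0)) (K.inv_fst_ne _ _) : StarVertex w v × Fin 3).1 := by
    intro t
    rcases eq_turn (τ v) 0 t with rfl | ht | ht
    · rfl
    · rw [hturn 0]
      simp only [ht]
    · rw [hturn t]
      simp only [← ht]
  have hr : ∀ t, f (right (G.inv (v, t)) (G.inv_fst_ne _ _) : StarVertex w v × Fin 3).1 =
      f (left (K.inv (w, 0)) (K.inv_fst_ne _ _) : StarVertex w v × Fin 3).1 := by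
    intro t
    rw [← hl (-t), ← hf, star_inv_right_port]
  generalize f (left (K.inv (w, 0)) (K.inv_fst_ne _ _) : StarVertex w v × Fin 3).1 = c at hl hr
  have hL : ∀ x, f (Sum.inl x) = c := by
    let fK : V → Prop := fun x => if h : x ≠ w then f (Sum.inl ⟨x, h⟩) else c
    have h1 : ∀ x h, fK x = f (Sum.inl ⟨x, h⟩) := fun x h => dif_pos h
    have h2 : fK w = c := dif_neg (by simp)
    have h3 : ∀ d : V × Fin 3, fK (K.inv d).1 = fK d.1 := by
      intro d
      by_cases hd : d.1 = w
      · obtain ⟨x, t⟩ := d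
        obtain rfl : x = w := hd
        rw [h2, h1 _ (K.fst_ne _)]
        exact hl t
      · by_cases hd' : (K.inv d).1 = w
        · rw [hd', h2, h1 _ hd, ← hl (K.inv d).2]
          congr 2
          simp only [left, ← eq_port hd']
        · have h4 := hf (left d hd)
          rw [star_inv_left K w G v hd hd'] at h4
          rw [h1 _ hd, h1 _ hd']
          exact h4
    intro x
    rw [← h2, ← eq_of_connected hK h3 x.1 w, h1 _ x.2]
  have hR : ∀ y, f (Sum.inr y) = c := by
    let fG : W → Prop := fun x => if h : x ≠ v then f (Sum.inr ⟨x, h⟩) else c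
    have h1 : ∀ x h, fG x = f (Sum.inr ⟨x, h⟩) := fun x h => dif_pos h
    have h2 : fG v = c := dif_neg (by simp)
    have h3 : ∀ d : W × Fin 3, fG (G.inv d).1 = fG d.1 := by
      intro d
      by_cases hd : d.1 = v
      · obtain ⟨x, t⟩ := d
        obtain rfl : x = v := hd
        rw [h2, h1 _ (G.fst_ne _)]
        exact hr t
      · by_cases hd' : (G.inv d).1 = v
        · rw [hd', h2, h1 _ hd, ← hr (G.inv d).2]
          congr 2
          simp only [right, ← eq_port hd']
        · have h4 := hf (right d hd)
          rw [star_inv_right K w G v hd hd'] at h4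
          rw [h1 _ hd, h1 _ hd']
          exact h4
    intro x
    rw [← h2, ← eq_of_connected hG h3 x.1 v, h1 _ x.2]
  rintro (x | x) (y | y) <;> simp only [hL, hR]

end Star

/-! ### Tables of faces -/

/-- The byte with index `k` of the number `table`, which encodes a table of small numbers. -/
def entry (table k : ℕ) : ℕ := table / 256 ^ k % 256

/-- The faces of an embedding in a form that can be checked dart by dart: `label` is constant
along the faces, and each dart is led to the representative of its label by walking along its
face, `rank` being the number of steps left. -/
structure FaceTable {V : Type*} (C : CubicData V) (σ : V → Bool) (m : ℕ) where
  label : V × Fin 3 → Fin m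
  rank : V × Fin 3 → ℕ
  rep : Fin m → V × Fin 3
  label_face : ∀ d, label (C.face σ d) = label d
  label_rep : ∀ l, label (rep l) = l
  rank_face : ∀ d, d = rep (label d) ∨ rank (C.face σ d) + 1 = rank d

namespace FaceTable

variable {V : Type*} {C : CubicData V} {σ : V → Bool} {m : ℕ} (D : FaceTable C σ m)

theorem sameCycle_rep (d : V × Fin 3) : (C.face σ).SameCycle d (D.rep (D.label d)) := by
  induction h : D.rank d using Nat.strong_induction_on generalizing d with
  | _ k ih =>
    rcases D.rank_face d with hd | hd
    · rw [← hd]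
    · have := ih (D.rank (C.face σ d)) (by omega) _ rfl
      rw [D.label_face] at this
      exact Equiv.Perm.sameCycle_apply_left.1 this

/-- The labelling of the darts by their faces. -/
def labelling : C.Labelling σ (Fin m) where
  L := D.label
  face_eq := D.label_face
  sameCycle d d' hd := by
    refine (D.sameCycle_rep d).trans ?_
    rw [hd]
    exact (D.sameCycle_rep d').symm
  surj l := ⟨_, D.label_rep l⟩

end FaceTable

/-! ### Cyclic covers -/

section Cover

variable {B : Type*} (C : CubicData B) (s : B × Fin 3 → ℤ) (hs : ∀ d, s (C.inv d) = -s d) (n : ℕ)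

/-- The cyclic cover with voltages `s` in `ZMod n`. -/
def cover : CubicData (B × ZMod n) where
  inv e := (((C.inv (e.1.1, e.2)).1, e.1.2 + s (e.1.1, e.2)), (C.inv (e.1.1, e.2)).2)
  inv_inv e := by
    obtain ⟨⟨b, i⟩, t⟩ := e
    simp only [Prod.mk.eta, C.inv_inv, hs, Int.cast_neg, add_neg_cancel_right]
  fst_ne e h := C.fst_ne (e.1.1, e.2) (congrArg (fun x : B × ZMod n => x.1) h)
  inj v t t' h := C.inj v.1 t t' (congrArg (fun x : B × ZMod n => x.1) h)

variable {C s n} {σ : B → Bool} {Λ : Type*}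

theorem cover_face (b : B) (i : ZMod n) (t : Fin 3) :
    (C.cover s hs n).face (fun x => σ x.1) ((b, i), t) =
      (((C.face σ (b, t)).1, i + s (b, t)), (C.face σ (b, t)).2) := rfl

/-- If the voltages add up to zero along each face, which the potential `o` expresses, then each
face of the base lifts to `n` faces of the cover. -/
def coverLabelling [Finite B] (ℓ : C.Labelling σ Λ) (o : B × Fin 3 → ℤ)
    (ho : ∀ d, o (C.face σ d) = o d + s d) :
    (C.cover s hs n).Labelling (fun x => σ x.1) (Λ × ZMod n) where
  L e := (ℓ.L (e.1.1, e.2), e.1.2 - o (e.1.1, e.2))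
  face_eq := by
    rintro ⟨⟨b, i⟩, t⟩
    rw [cover_face]
    simp only [Prod.mk.eta, ℓ.face_eq, ho, Int.cast_add, add_sub_add_right_eq_sub]
  sameCycle := by
    rintro ⟨⟨b, i⟩, t⟩ ⟨⟨b', i'⟩, t'⟩ h
    obtain ⟨h1, h2⟩ := Prod.mk.inj h
    obtain ⟨k, hk⟩ := (ℓ.sameCycle _ _ h1).exists_nat_pow_eq
    have key : ∀ k : ℕ, ((C.cover s hs n).face (fun x => σ x.1) ^ k) ((b, i), t) =
        ((((C.face σ ^ k) (b, t)).1, i + (o ((C.face σ ^ k) (b, t)) - o (b, t) : ℤ)),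
          ((C.face σ ^ k) (b, t)).2) := by
      intro k
      induction k with
      | zero => simp
      | succ k ih =>
        rw [pow_succ', Equiv.Perm.mul_apply, ih, cover_face, pow_succ', Equiv.Perm.mul_apply]
        simp only [Prod.mk.eta, ho]
        push_cast
        ring_nf
    refine ⟨k, ?_⟩
    rw [zpow_natCast, key, hk]
    simp only [Int.cast_sub]
    have h3 : i + ((o (b', t') : ZMod n) - (o (b, t) : ZMod n)) = i' := by
      linear_combination h2
    rw [h3]
  surj := by
    rintro ⟨a, i⟩
    obtain ⟨⟨b, t⟩, rfl⟩ := ℓ.surj a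
    exact ⟨((b, i + o (b, t)), t), by simp⟩

theorem intCast_zmod_ne {n : ℕ} {a : ℤ} (h0 : a ≠ 0) (h : a.natAbs < n) : (a : ZMod n) ≠ 0 := by
  rw [Ne, ZMod.intCast_zmod_eq_zero_iff_dvd]
  intro hd
  exact h0 (Int.eq_zero_of_abs_lt_dvd hd (by rw [Int.abs_eq_natAbs]; exact_mod_cast h))

/-- A condition on the base under which all cyclic covers with `N ≤ n` are polyhedral: the base need
not be, but where it fails the offsets of the lifted faces differ, by less than `N` and thus also
modulo `n`. -/
structure CoverGood (ℓ : C.Labelling σ Λ) (s o : B × Fin 3 → ℤ) (N : ℕ) : Prop where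
  vertex : ∀ b t t', t ≠ t' → ℓ.L (b, t) = ℓ.L (b, t') →
    o (b, t) - o (b, t') ≠ 0 ∧ (o (b, t) - o (b, t')).natAbs < N
  edge : ∀ d d', d ≠ d' → ℓ.L d = ℓ.L d' → ℓ.L (C.inv d) = ℓ.L (C.inv d') →
    o d + s d - o (C.inv d) - (o d' + s d' - o (C.inv d')) ≠ 0 ∧
      (o d + s d - o (C.inv d) - (o d' + s d' - o (C.inv d'))).natAbs < N

theorem CoverGood.good [Finite B] {ℓ : C.Labelling σ Λ} {o : B × Fin 3 → ℤ} {N : ℕ}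
    (h : CoverGood ℓ s o N) (ho : ∀ d, o (C.face σ d) = o d + s d) (hn : N ≤ n) :
    (coverLabelling (n := n) hs ℓ o ho).Good where
  vertex := by
    rintro ⟨b, i⟩ t t' heq
    by_contra hne
    obtain ⟨h1, h2⟩ := Prod.mk.inj heq
    obtain ⟨h3, h4⟩ := h.vertex b t t' hne h1
    refine intCast_zmod_ne h3 (h4.trans_le hn) ?_
    push_cast
    linear_combination -h2
  edge := by
    rintro ⟨⟨b, i⟩, t⟩ ⟨⟨b', i'⟩, t'⟩ h1 h2
    obtain ⟨h3, h4⟩ := Prod.mk.inj h1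
    obtain ⟨h5, h6⟩ := Prod.mk.inj h2
    have hd : (b, t) = (b', t') := by
      by_contra hne
      obtain ⟨h7, h8⟩ := h.edge _ _ hne h3 h5
      refine intCast_zmod_ne h7 (h8.trans_le hn) ?_
      simp only [cover, Prod.mk.eta] at h6
      push_cast
      simp only at h4
      linear_combination h6 - h4
    obtain ⟨rfl, rfl⟩ := Prod.mk.inj hd
    simp only [sub_left_inj] at h4
    rw [h4]

/-- Two edges with the same faces on both sides spoil all covers if these faces lift to the
same pairs. -/
theorem coverLabelling_not_good [Finite B] {ℓ : C.Labelling σ Λ} {o : B × Fin 3 → ℤ}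
    (ho : ∀ d, o (C.face σ d) = o d + s d) {d d' : B × Fin 3} (hne : d ≠ d')
    (h : ℓ.L d = ℓ.L d') (h' : ℓ.L (C.inv d) = ℓ.L (C.inv d'))
    (hk : o d + s d - o (C.inv d) = o d' + s d' - o (C.inv d')) :
    ¬ (coverLabelling (n := n) hs ℓ o ho).Good := by
  intro hgood
  have h1 := hgood.edge ((d.1, (o d : ZMod n)), d.2) ((d'.1, (o d' : ZMod n)), d'.2)
    (Prod.ext h (by simp [coverLabelling]))
    (Prod.ext h' (by simp only [coverLabelling, cover, Prod.mk.eta]; exact_mod_cast congrArg _ hk))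
  exact hne (Prod.ext (congrArg (fun x : (B × ZMod n) × Fin 3 => x.1.1) h1)
    (congrArg (fun x : (B × ZMod n) × Fin 3 => x.2) h1))

end Cover

/-! ### Rigidity of chordless 5-cycles -/

section FiveCycle

/-- The combinatorial core of `eq_of_five_cycle`: `a i` and `c i` are the faces on the two sides of
the edge `i` of a 5-cycle, `p i` and `q i` those of the third edge at the vertex `i`, and `τ i` is
the orientation there. If the orientations were not constant, two of the third edges would lie
on the same two faces, or some face would visit a vertex twice. -/
theorem eq_of_five_labels {Λ : Type*} {a c p q : Fin 5 → Λ} {τ : Fin 5 → Bool}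
    (hpos : ∀ i, τ (i + 1) = true → a i = a (i + 1) ∧ c (i + 1) = p (i + 1) ∧ q (i + 1) = c i)
    (hneg : ∀ i, τ (i + 1) = false →
      a i = p (i + 1) ∧ q (i + 1) = a (i + 1) ∧ c (i + 1) = c i)
    (h1 : ∀ i, a i ≠ p i) (h2 : ∀ i, p (i + 1) ≠ c i)
    (h3 : ∀ i j, p i = q j → q i = p j → False) (i j : Fin 5) : τ i = τ j := by
  have p0 := hpos 0; have p1 := hpos 1; have p2 := hpos 2; have p3 := hpos 3; have p4 := hpos 4
  have n0 := hneg 0; have n1 := hneg 1; have n2 := hneg 2; have n3 := hneg 3; have n4 := hneg 4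
  simp only [Fin.isValue, zero_add, Fin.reduceAdd] at p0 p1 p2 p3 p4 n0 n1 n2 n3 n4
  have a0 := h1 0; have a1 := h1 1; have a2 := h1 2; have a3 := h1 3; have a4 := h1 4
  have b0 := h2 0; have b1 := h2 1; have b2 := h2 2; have b3 := h2 3; have b4 := h2 4
  simp only [Fin.isValue, zero_add, Fin.reduceAdd] at b0 b1 b2 b3 b4
  have e01 := h3 0 1; have e02 := h3 0 2; have e03 := h3 0 3; have e04 := h3 0 4
  have e12 := h3 1 2; have e13 := h3 1 3; have e14 := h3 1 4
  have e23 := h3 2 3; have e24 := h3 2 4; have e34 := h3 3 4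
  clear hpos hneg h1 h2 h3
  suffices h : τ 0 = τ 1 ∧ τ 0 = τ 2 ∧ τ 0 = τ 3 ∧ τ 0 = τ 4 by
    have : ∀ i, τ 0 = τ i := by
      intro i
      fin_cases i
      exacts [rfl, h.1, h.2.1, h.2.2.1, h.2.2.2]
    rw [← this i, ← this j]
  generalize τ 0 = t0 at *; generalize τ 1 = t1 at *; generalize τ 2 = t2 at *
  generalize τ 3 = t3 at *; generalize τ 4 = t4 at *
  cases t0 <;> cases t1 <;> cases t2 <;> cases t3 <;> cases t4 <;> grind

/-- The third dart at the start of `d`, which is neither on the face of `d` for the constant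
orientation `true` nor on the edge before `d` on this face. -/
def outer {V : Type*} (d : V × Fin 3) : V × Fin 3 := (d.1, turn true d.2)

/-- In a polyhedral embedding the orientations along a 5-cycle without chords agree, if the cycle is
a face for the constant orientation. -/
theorem eq_of_five_cycle {V Λ : Type*} {C : CubicData V} {σ : V → Bool} {ℓ : C.Labelling σ Λ}
    (h : ℓ.Good) (e : Fin 5 → V × Fin 3) (he : ∀ i, C.face (fun _ => true) (e i) = e (i + 1))
    (hch : ∀ i j, outer (e i) ≠ C.inv (outer (e j))) (i j : Fin 5) :
    σ (e i).1 = σ (e j).1 := by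
  have hturn : ∀ b t, turn b (turn true t) = if b then t + 2 else t := by decide
  have hturn2 : ∀ t, turn true (turn true (turn true t)) = t := by decide
  have hturn3 : ∀ t, turn false (turn true (turn true t)) = turn true t := by decide
  have hout : ∀ i, (outer (e (i + 1))) = ((C.inv (e i)).1, turn true (turn true (C.inv (e i)).2)) :=
    fun i => by rw [← he]; rfl
  have hfst : ∀ i, (e (i + 1)).1 = (C.inv (e i)).1 := fun i => by rw [← he]; rfl
  have hsnd : ∀ i, (e (i + 1)).2 = turn true (C.inv (e i)).2 := fun i => by rw [← he]; rfl
  refine eq_of_five_labels (a := fun i => ℓ.L (e i)) (c := fun i => ℓ.L (C.inv (e i)))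
    (p := fun i => ℓ.L (outer (e i))) (q := fun i => ℓ.L (C.inv (outer (e i))))
    (τ := fun i => σ (e i).1) ?_ ?_ ?_ ?_ ?_ i j
  · intro i hi
    refine ⟨?_, ?_, ?_⟩
    · rw [← ℓ.face_eq (e i), C.face_apply, ← hfst, hi, ← hsnd]
    · rw [ℓ.inv_eq, hi]
      rfl
    · rw [ℓ.inv_eq, hout, ← hfst, hi, hturn2, hfst]
  · intro i hi
    refine ⟨?_, ?_, ?_⟩
    · rw [← ℓ.face_eq (e i), C.face_apply, ← hfst, hi, hout, ← hfst, turn_turn]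
      rfl
    · rw [ℓ.inv_eq, hout, ← hfst, hi, hturn3, ← hsnd]
    · rw [ℓ.inv_eq, hi, hsnd, hturn, hfst]
      rfl
  · intro i hi
    exact turn_ne true _ (h.vertex (e i).1 _ _ hi).symm
  · intro i hi
    simp only [hout] at hi
    have h1 := h.vertex _ _ (C.inv (e i)).2 hi
    revert h1
    generalize (C.inv (e i)).2 = t
    revert t
    decide
  · intro i j h1 h2
    refine hch i j (h.edge _ _ h1 ?_)
    simp only [C.inv_inv]
    exact h2

/-- The face through `d` for the constant orientation has length five, and it lifts to chordless
5-cycles of the cyclic covers. -/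
structure IsPentagon {B : Type*} (C : CubicData B) (s : B × Fin 3 → ℤ) (d : B × Fin 3) : Prop where
  closed : (C.face fun _ => true)^[5] d = d
  sum_eq_zero : ∑ k ∈ Finset.range 5, s ((C.face fun _ => true)^[k] d) = 0
  chordless : ∀ i j : Fin 5, outer ((C.face fun _ => true)^[i] d) ≠
    C.inv (outer ((C.face fun _ => true)^[j] d))

theorem IsPentagon.eq {B Λ : Type*} {C : CubicData B} {s : B × Fin 3 → ℤ} {d : B × Fin 3}
    (hd : IsPentagon C s d) {hs : ∀ d, s (C.inv d) = -s d} {n : ℕ} {σ : B × ZMod n → Bool}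
    {ℓ : (C.cover s hs n).Labelling σ Λ} (h : ℓ.Good) (k : ZMod n) (i : ℕ) (hi : i < 5) :
    σ (((C.face fun _ => true)^[i] d).1,
      k + (∑ k ∈ Finset.range i, s ((C.face fun _ => true)^[k] d) : ℤ)) = σ (d.1, k) := by
  let e : Fin 5 → (B × ZMod n) × Fin 3 := fun i =>
    ((((C.face fun _ => true)^[i] d).1,
      k + (∑ k ∈ Finset.range i, s ((C.face fun _ => true)^[k] d) : ℤ)),
      ((C.face fun _ => true)^[i] d).2)
  have h0 : e 0 = ((d.1, k), d.2) := by simp [e]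
  have := eq_of_five_cycle h e ?_ ?_ ⟨i, hi⟩ 0
  · rw [h0] at this
    exact this
  · intro i
    have hval : ∀ j, C.face (fun _ => true) ((C.face fun _ => true)^[j] d) =
        (C.face fun _ => true)^[j + 1] d := fun j => (Function.iterate_succ_apply' _ _ _).symm
    have hstep : (C.cover s hs n).face (fun _ => true) (e i) =
        ((((C.face fun _ => true)^[i.1 + 1] d).1,
          k + (∑ k ∈ Finset.range (i.1 + 1), s ((C.face fun _ => true)^[k] d) : ℤ)),
          ((C.face fun _ => true)^[i.1 + 1] d).2) := by
      refine (cover_face hs (σ := fun _ => true) _ _ _).trans ?_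
      rw [Prod.mk.eta, hval, Finset.sum_range_succ, Int.cast_add, add_assoc]
    rw [hstep]
    rcases Nat.lt_or_ge (i.1 + 1) 5 with hlt | hge
    · have : (i + 1).1 = i.1 + 1 := Fin.val_add_one_of_lt' hlt
      simp only [e, this]
    · obtain rfl : i = 4 := Fin.ext (by have := i.2; simp; omega)
      have h5 : ((4 : Fin 5) : ℕ) + 1 = 5 := rfl
      rw [h5, hd.closed, hd.sum_eq_zero]
      simp [h0]
  · intro i j hij
    refine hd.chordless i j ?_
    have := congrArg (fun x : (B × ZMod n) × Fin 3 => (x.1.1, x.2)) hij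
    exact this

end FiveCycle

/-! ### Pairs of ladders -/

/-- The vertices in one period of a pair of ladders: the ladder, the kind of the vertex (`0` for the
top end of a rung, `1` for its bottom end, `2` for the foot of a link to the other ladder), and the
position. -/
abbrev LadderVertex : Type := Bool × Fin 3 × Fin 7

/-- The reversal of darts in a pair of closed ladders with seven rungs each. The link at the
position `i` of the ladder `r` starts between the rungs `i` and `i + 1`, on the top rail if `T r i`
holds and on the bottom rail otherwise, and it leads to the position `p r i` of the other ladder. -/
def ladderInv (T : Bool → Fin 7 → Bool) (p : Bool → Fin 7 → Fin 7) :
    LadderVertex × Fin 3 → LadderVertex × Fin 3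
  | ((r, 0, i), 0) => if T r i then ((r, 2, i), 2) else ((r, 0, i + 1), 1)
  | ((r, 0, i), 1) => if T r (i - 1) then ((r, 2, i - 1), 0) else ((r, 0, i - 1), 0)
  | ((r, 0, i), 2) => ((r, 1, i), 1)
  | ((r, 1, i), 0) => if T r i then ((r, 1, i + 1), 2) else ((r, 2, i), 1)
  | ((r, 1, i), 1) => ((r, 0, i), 2)
  | ((r, 1, i), 2) => if T r (i - 1) then ((r, 1, i - 1), 0) else ((r, 2, i - 1), 0)
  | ((r, 2, i), 0) => if T r i then ((r, 0, i + 1), 1) else ((r, 1, i + 1), 2)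
  | ((r, 2, i), 1) =>
    if T r i then ((!r, 2, p r i), if T (!r) (p r i) then 1 else 2) else ((r, 1, i), 0)
  | ((r, 2, i), 2) =>
    if T r i then ((r, 0, i), 0) else ((!r, 2, p r i), if T (!r) (p r i) then 1 else 2)

/-- The voltages: a ladder winds once around the cyclic group when it closes up, and the link at the
position `i` of the ladder `r` has the voltage `q r i`. -/
def ladderShift (T : Bool → Fin 7 → Bool) (q : Bool → Fin 7 → ℤ) : LadderVertex × Fin 3 → ℤ
  | ((r, 0, i), 0) => if T r i then 0 else if i = 6 then 1 else 0
  | ((_, 0, i), 1) => if i = 0 then -1 else 0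
  | ((_, 0, _), 2) => 0
  | ((r, 1, i), 0) => if T r i then if i = 6 then 1 else 0 else 0
  | ((_, 1, _), 1) => 0
  | ((_, 1, i), 2) => if i = 0 then -1 else 0
  | ((_, 2, i), 0) => if i = 6 then 1 else 0
  | ((r, 2, i), 1) => if T r i then q r i else 0
  | ((r, 2, i), 2) => if T r i then 0 else q r i

/-- A pair of ladders with links between them, as a base graph with voltages: `T` places the feet of
the links on the rails, `p` says where the links lead to, and `q` gives their voltages. -/
structure LadderPair where
  T : Bool → Fin 7 → Bool
  p : Bool → Fin 7 → Fin 7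
  q : Bool → Fin 7 → ℤ
  inv_inv : ∀ d, ladderInv T p (ladderInv T p d) = d
  fst_ne : ∀ d, (ladderInv T p d).1 ≠ d.1
  inj : ∀ v s t, (ladderInv T p (v, s)).1 = (ladderInv T p (v, t)).1 → s = t
  shift_inv : ∀ d, ladderShift T q (ladderInv T p d) = -ladderShift T q d

namespace LadderPair

variable (P : LadderPair)

/-- The base graph. -/
def base : CubicData LadderVertex where
  inv := ladderInv P.T P.p
  inv_inv := P.inv_inv
  fst_ne := P.fst_ne
  inj := P.inj

/-- The voltages of the base graph. -/
def shift : LadderVertex × Fin 3 → ℤ := ladderShift P.T P.q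

/-- The cyclic cover of order `n`, which consists of two closed ladders with `7 * n` rungs each. -/
def data (n : ℕ) : CubicData (LadderVertex × ZMod n) := P.base.cover P.shift P.shift_inv n

/-- The orientations that are constant on both ladders: `true` on the first one and `b` on the
second one. -/
def ladderSign (b : Bool) (v : LadderVertex) : Bool := !v.1 || b

/-- The darts along the cell `i` of the ladder `r`, which lies between the rungs `i` and `i + 1` and
is a face for the constant orientation. It starts with the rung `i`. -/
def walk (r : Bool) (i : Fin 7) (k : ℕ) : LadderVertex × Fin 3 :=
  (P.base.face fun _ => true)^[k] ((r, 1, i), 1)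

/-- The sum of the voltages along the first `k` darts of a cell. -/
def walkShift (r : Bool) (i : Fin 7) (k : ℕ) : ℤ :=
  ∑ j ∈ Finset.range k, P.shift (P.walk r i j)

/-- The cells of the ladders are pentagons, which contain the top ends of their two rungs and the
foot of a link. Adjacent cells share a rung, so the orientations agree all along a ladder. -/
structure HasPentagons : Prop where
  closed : ∀ r i, P.walk r i 5 = ((r, 1, i), 1)
  sum_eq_zero : ∀ r i, P.walkShift r i 5 = 0
  chordless : ∀ r i, ∀ j k : Fin 5, outer (P.walk r i j) ≠ P.base.inv (outer (P.walk r i k))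
  top : ∀ r i, ∃ k : Fin 5, (P.walk r i k).1 = (r, 0, i) ∧ P.walkShift r i k = 0
  foot : ∀ r i, ∃ k : Fin 5, (P.walk r i k).1 = (r, 2, i) ∧ P.walkShift r i k = 0
  next : ∀ r i, ∃ k : Fin 5, (P.walk r i k).1 = (r, 0, i + 1) ∧
    P.walkShift r i k = if i = 6 then 1 else 0

variable {P}

/-- A function that is constant along the pentagons is constant on each of the two ladders. -/
theorem HasPentagons.eq_of_walk (hP : P.HasPentagons) {n : ℕ} [NeZero n] {X : Type*}
    {f : LadderVertex × ZMod n → X}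
    (hf : ∀ r i (k : Fin 5) (x : ZMod n),
      f ((P.walk r i k).1, x + P.walkShift r i k) = f ((r, 1, i), x)) (v : LadderVertex × ZMod n) :
    f v = f ((v.1.1, 0, 0), 0) := by
  have h0 : ∀ r i x, f ((r, 0, i), x) = f ((r, 1, i), x) := by
    intro r i x
    obtain ⟨k, h1, h2⟩ := hP.top r i
    have := hf r i k x
    rwa [h1, h2, Int.cast_zero, add_zero] at this
  have h2 : ∀ r i x, f ((r, 2, i), x) = f ((r, 1, i), x) := by
    intro r i x
    obtain ⟨k, h1, h2⟩ := hP.foot r i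
    have := hf r i k x
    rwa [h1, h2, Int.cast_zero, add_zero] at this
  have h3 : ∀ r i x, i ≠ 6 → f ((r, 0, i + 1), x) = f ((r, 0, i), x) := by
    intro r i x hi
    obtain ⟨k, h1, h2⟩ := hP.next r i
    have := hf r i k x
    rwa [h1, h2, if_neg hi, Int.cast_zero, add_zero, ← h0] at this
  have h4 : ∀ r x, f ((r, 0, 0), x + 1) = f ((r, 0, 6), x) := by
    intro r x
    obtain ⟨k, h1, h2⟩ := hP.next r 6
    have := hf r 6 k x
    rwa [h1, h2, if_pos rfl, Int.cast_one, ← h0] at this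
  have h5 : ∀ r i x, f ((r, 0, i), x) = f ((r, 0, 0), x) := by
    intro r i x
    induction i using Fin.induction with
    | zero => rfl
    | succ i ih =>
      have hi : i.castSucc ≠ 6 := by
        intro h
        have h' := congrArg Fin.val h
        have := i.2
        simp at h'
        omega
      rw [← ih, ← h3 r i.castSucc x hi]
      congr 4
      exact (Fin.coeSucc_eq_succ).symm
  have h6 : ∀ r (x : ℕ), f ((r, 0, 0), (x : ZMod n)) = f ((r, 0, 0), 0) := by
    intro r x
    induction x with
    | zero => rw [Nat.cast_zero]
    | succ x ih => rw [Nat.cast_succ, h4, h5, ih]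
  have h7 : ∀ r i x, f ((r, 0, i), x) = f ((r, 0, 0), 0) := by
    intro r i x
    rw [h5, ← ZMod.natCast_zmod_val x, h6]
  obtain ⟨⟨r, k, i⟩, x⟩ := v
  fin_cases k
  · exact h7 r i x
  · exact (h0 r i x).symm.trans (h7 r i x)
  · exact ((h2 r i x).trans (h0 r i x).symm).trans (h7 r i x)

theorem HasPentagons.isPentagon (hP : P.HasPentagons) (r i) :
    IsPentagon P.base P.shift ((r, 1, i), 1) :=
  ⟨hP.closed r i, hP.sum_eq_zero r i, hP.chordless r i⟩

theorem HasPentagons.connected (hP : P.HasPentagons) (n : ℕ) [NeZero n] :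
    (P.data n).graph.Connected := by
  refine connected_of_forall fun f hf => ?_
  have hwalk : ∀ r i (k : ℕ) (x : ZMod n),
      f ((P.walk r i k).1, x + P.walkShift r i k) = f ((r, 1, i), x) := by
    intro r i k x
    induction k with
    | zero => simp [walk, walkShift]
    | succ k ih =>
      rw [← ih, ← hf (((P.walk r i k).1, x + P.walkShift r i k), (P.walk r i k).2)]
      rw [walkShift, Finset.sum_range_succ, ← walkShift, walk, Function.iterate_succ_apply', ← walk,
        Int.cast_add, ← add_assoc]
      rfl
  have h := hP.eq_of_walk (f := f) fun r i k x => hwalk r i k x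
  have h2 : f ((true, 0, 0), 0) = f ((false, 0, 0), 0) := by
    obtain ⟨t, ht⟩ : ∃ t, (P.base.inv ((false, 2, 0), t)).1.1 = true := by
      cases h : P.T false 0
      · exact ⟨2, by simp [base, ladderInv, h]⟩
      · exact ⟨1, by simp [base, ladderInv, h]⟩
    have h3 := hf (((false, 2, 0), 0), t)
    rw [h, h ((false, 2, 0), 0)] at h3
    rw [← h3, ← ht]
    rfl
  intro u v
  rw [h u, h v]
  rcases u.1.1 <;> rcases v.1.1 <;> simp [h2]

/-- Up to mirror images, a pair of ladders has at most two polyhedral embeddings, since pentagons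
force the orientations to be constant on each ladder. -/
theorem HasPentagons.exists_eq (hP : P.HasPentagons) {n : ℕ} [NeZero n]
    {σ : LadderVertex × ZMod n → Bool} (h : ((P.data n).rot σ).IsPolyhedral) :
    ∃ b, σ = (fun v => ladderSign b v.1) ∨ σ = fun v => !ladderSign b v.1 := by
  have hgood := (Labelling.ofFace (P.data n) σ).good_of_isPolyhedral h
  have h1 := hP.eq_of_walk (f := σ) fun r i k x => (hP.isPentagon r i).eq hgood x k k.2
  refine ⟨σ ((true, 0, 0), 0) == σ ((false, 0, 0), 0), ?_⟩
  cases h2 : σ ((false, 0, 0), 0)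
  · right
    funext v
    rw [h1]
    rcases hv : v.1.1 <;> simp [ladderSign, hv, h2]
  · left
    funext v
    rw [h1]
    rcases hv : v.1.1 <;> simp [ladderSign, hv, h2]

section Faces

/-- The position of a dart of the base graph in the tables below. The offsets are stored there with
`100` added, to make them positive. -/
def dartIndex (d : LadderVertex × Fin 3) : ℕ :=
  (((if d.1.1 then 3 else 0) + d.1.2.1.val) * 7 + d.1.2.2.val) * 3 + d.2.val

variable (P) in
/-- The faces of the base graph, with a potential for the voltages along them. -/
structure FaceData (b : Bool) (m : ℕ) extends FaceTable P.base (ladderSign b) m where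
  offset : LadderVertex × Fin 3 → ℤ
  offset_face : ∀ d, offset (P.base.face (ladderSign b) d) = offset d + P.shift d

namespace FaceData

variable {b : Bool} {m : ℕ} (D : P.FaceData b m)

/-- The faces of the cover. -/
def coverLabelling (n : ℕ) : (P.data n).Labelling (fun v => ladderSign b v.1) (Fin m × ZMod n) :=
  CubicData.coverLabelling P.shift_inv D.labelling D.offset D.offset_face

/-- Euler's formula, for `42 * n` vertices and `m * n` faces. -/
theorem hasGenus_iff (D : P.FaceData b m) {n : ℕ} [NeZero n] (g : ℕ) :
    ((P.data n).rot fun v => ladderSign b v.1).HasGenus g ↔ 2 * (m * n) + 4 * g = 42 * n + 4 := by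
  rw [(D.coverLabelling n).hasGenus_iff]
  simp

end FaceData

end Faces

/-! ### Two particular pairs of ladders -/

/-- The dart at a given position in the tables. -/
def ofDartIndex (k : ℕ) : LadderVertex × Fin 3 :=
  ((63 ≤ k, Fin.ofNat 3 (k / 21), Fin.ofNat 7 (k / 3)), Fin.ofNat 3 k)

/-- A pair for which both embeddings with constant orientations on the ladders are polyhedral. -/
def twoGenera : LadderPair where
  T r := if r then ![true, false, false, false, false, true, false]
    else ![true, false, true, true, true, true, true]
  p r := if r then ![2, 5, 3, 1, 4, 6, 0] else ![6, 3, 0, 2, 4, 1, 5]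
  q r := if r then ![-3, 2, 0, -2, -1, 0, -3] else ![3, 2, 3, 0, 1, -2, 0]
  inv_inv := by decide +kernel
  fst_ne := by decide +kernel
  inj := by decide +kernel
  shift_inv := by decide +kernel

theorem twoGenera_hasPentagons : twoGenera.HasPentagons where
  closed := by decide +kernel
  sum_eq_zero := by decide +kernel
  chordless := by decide +kernel
  top := by decide +kernel
  foot := by decide +kernel
  next := by decide +kernel

/-- The embedding of `twoGenera` with 17 faces per period. -/
def twoGeneraFaces : twoGenera.FaceData true 17 where
  label d := Fin.ofNat 17 (entry
    0x20a02020610030f02030e03060d03020c0606020b100a020f10020e0f030d0e030c0d060b0c020a0b0210060a0f02100e020f0d020e0c020d0b020c0a060b060200020609030208060307020605030403020201090003080903070803050703040503010403000103090600080209070308050607040205010204000201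
    (dartIndex d))
  offset d := entry
    0x676363636664666467656466646465646464676364646367646467646466646465646464646464646464646663646364646364646364646364646364646764666363666664656664646564606464646463646064646363646463646463646463646463646464646464646663646664646564646464646064646064646464
    (dartIndex d) - 100
  rank d := entry
    0x1030b1608030d010407010f0201090801040b100301020202000302000e02000802000301000904000a020901031504031404031304031204021104000a040717010705030c0503010a030f0c03100106000c03010301010002010003010004020005010011040000020602020604020b04020004030e04020d04001804
    (dartIndex d)
  rep l := ofDartIndex (entry 0x64615e5b58554125221f0a1c19152c1602 l)
  label_face := by decide +kernel
  label_rep := by decide +kernel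
  offset_face := by decide +kernel
  rank_face := by decide +kernel

theorem twoGenera_coverGood :
    CoverGood twoGeneraFaces.labelling twoGenera.shift twoGeneraFaces.offset 60 where
  vertex := by decide +kernel
  edge := by decide +kernel

/-- The embedding of `twoGenera` with 15 faces per period. -/
def twoGeneraFaces' : twoGenera.FaceData false 15 where
  label d := Fin.ofNat 15 (entry
    0x202090e020202020d02020c02020b02020a080202020e09020d0e020c0d020b0c020a0b02080a020908090e020e0d020d0c020c0b020b0a020a0802080902020200020207020206020205020204020302020201070002060702050602040502030402010302000102070200060207050206040205030204010203000201
    (dartIndex d))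
  offset d := entry
    0x676463646a6364666466676467636463686464646a64646364646466646467646463646468646468646463646364646a64646a64646a64646a64646a6464646a6363656a64636564676364616764656464646164646364646464646464646464646464646465646465646a63646564646364646764646164646164646464
    (dartIndex d) - 100
  rank d := entry
    0x12d010108352a20031e140312260324040301320e2c03022b02041f020413020425020403030402000403023400010900010a00010b00010c00020d000433073601230503292103112703310f0315011d002e0301031801001901001a01001b02001c010016040017020602022204022804021004033004022f04003704
    (dartIndex d)
  rep l := ofDartIndex (entry 0x504d4a4744554125221f1c192c1602 l)
  label_face := by decide +kernel
  label_rep := by decide +kernel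
  offset_face := by decide +kernel
  rank_face := by decide +kernel

theorem twoGenera_coverGood' :
    CoverGood twoGeneraFaces'.labelling twoGenera.shift twoGeneraFaces'.offset 60 where
  vertex := by decide +kernel
  edge := by decide +kernel

/-- A pair for which only one of the embeddings with constant orientations on the ladders is
polyhedral, namely the one with fewer faces. -/
def highGenus : LadderPair where
  T r := if r then ![true, false, false, true, true, false, true]
    else ![true, false, true, true, true, true, true]
  p r := if r then ![4, 5, 0, 1, 2, 3, 6] else ![2, 3, 4, 5, 0, 1, 6]
  q r := if r then ![4, 2, -1, 4, 0, 6, -3] else ![1, -4, 0, -6, -4, -2, 3]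
  inv_inv := by decide +kernel
  fst_ne := by decide +kernel
  inj := by decide +kernel
  shift_inv := by decide +kernel

theorem highGenus_hasPentagons : highGenus.HasPentagons where
  closed := by decide +kernel
  sum_eq_zero := by decide +kernel
  chordless := by decide +kernel
  top := by decide +kernel
  foot := by decide +kernel
  next := by decide +kernel

/-- The polyhedral embedding of `highGenus`, with 15 faces per period. -/
def highGenusFaces : highGenus.FaceData true 15 where
  label d := Fin.ofNat 15 (entry
    0x20208020e0202020d02020c020b02020a020202090e08020d0e020c0d020b0c020a0b02090a020809020e02080d020e0c020d0b020c0a020b09020a080209020200020207020206020205020204020302020201070002060702050602040502030402010302000102070200060207050206040205030204010203000201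
    (dartIndex d))
  offset d := entry
    0x666a6367646c6d66646e6d646564676d64656b6e6464636c64646764646764646764646564646d64646d646663646664646d64646e64646e64646e64646b646763636f6764726f646d7264666d64726471646664646371646471646471646471646471646472646472646763646f64647264646d64646664646664646464
    (dartIndex d) - 100
  rank d := entry
    0x35070129011125320319230301012d0d010309150302031001002a01002b02002c02000201000e04000f0334020233040224040318040317040216040008040636010c0403140a032812033126031a0122002e0301031d01001e01001f01002002002101001b04001c020502020b04021304022704033004022f04003704
    (dartIndex d)
  rep l := ofDartIndex (entry 0x64615e5b58554125221f1c192c1602 l)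
  label_face := by decide +kernel
  label_rep := by decide +kernel
  offset_face := by decide +kernel
  rank_face := by decide +kernel

theorem highGenus_coverGood :
    CoverGood highGenusFaces.labelling highGenus.shift highGenusFaces.offset 60 where
  vertex := by decide +kernel
  edge := by decide +kernel

/-- The other embedding of `highGenus`, with 17 faces per period. -/
def highGenusFaces' : highGenus.FaceData false 17 where
  label d := Fin.ofNat 17 (entry
    0xb06020602100f03060e030302030d03060c0a020306100b020f10020e0f020d0e030c0d060a0c060b0a0b1006100f060f0e030e0d030d0c030c0a030a0b02060200030609020308060207030605030403020301090003080903070803050703040503010403000103090600080309070208050607040305010304000201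
    (dartIndex d))
  offset d := entry
    0x6364665e6564646464646364656564655f646467635e64636564646564646564646564645f64645f64646364646464646464646464636464636464636464676163636761646b6764646b64646464686467646464646367646467646467646467646467646468646468646163646764646b64646464646464646464646464
    (dartIndex d) - 100
  rank d := entry
    0x30a0b02050301030d010f0501190317060301091303020104030403030402020418020405030404000402010b00020c00020400011000011100021200040a090c01160703081403010603020e0306010e001a0301030901000a01000b01000c02000d010007040008020802021504020704020004030104020004000d04
    (dartIndex d)
  rep l := ofDartIndex (entry 0x504d4a4744554125221f0a1c19042c1602 l)
  label_face := by decide +kernel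
  label_rep := by decide +kernel
  offset_face := by decide +kernel
  rank_face := by decide +kernel

/-- Two edges of the base graph have the same faces on both sides, with the same offsets, so this
embedding is not polyhedral in any cover. -/
theorem highGenus_not_good (n : ℕ) : ¬ (highGenusFaces'.coverLabelling n).Good :=
  coverLabelling_not_good (d := ((false, 2, 5), 2)) (d' := ((false, 1, 5), 0)) _ _
    (by decide) (by decide +kernel) (by decide +kernel) (by decide +kernel)

end LadderPair

/-! ### Gaps in the polyhedral genera, and polyhedral genera that are far from minimal -/

namespace LadderPair

variable {P : LadderPair}

theorem _root_.RotationSystem.HasGenus.unique {V : Type*} {G : SimpleGraph V}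
    {R : RotationSystem G} {g g' : ℕ} (h : R.HasGenus g) (h' : R.HasGenus g') : g = g' := by
  unfold RotationSystem.HasGenus at h h'
  omega

theorem FaceData.polyGenus {b : Bool} {m : ℕ} (D : P.FaceData b m) {N n g : ℕ} [NeZero n]
    (h : CoverGood D.labelling P.shift D.offset N) (hn : N ≤ n)
    (hg : 2 * (m * n) + 4 * g = 42 * n + 4) :
    (P.data n).PolyGenus (fun v => ladderSign b v.1) g :=
  ⟨(h.good P.shift_inv D.offset_face hn).isPolyhedral, (D.hasGenus_iff g).2 hg⟩

/-- The polyhedral embeddings of a pair of ladders are among the two distinguished ones, up to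
mirror images. -/
theorem HasPentagons.exists_polyGenus (hP : P.HasPentagons) {n : ℕ} [NeZero n] {g : ℕ}
    (h : g ∈ polyhedralGenera (P.data n).graph) :
    ∃ b, (P.data n).PolyGenus (fun v => ladderSign b v.1) g := by
  obtain ⟨R, hR, hg⟩ := h
  obtain ⟨σ, rfl⟩ := (P.data n).exists_rot_eq R
  obtain ⟨b, rfl | rfl⟩ := hP.exists_eq hR
  · exact ⟨b, hR, hg⟩
  · refine ⟨b, ?_⟩
    have := PolyGenus.mirror (C := P.data n) ⟨hR, hg⟩
    simpa using this

theorem twoGenera_polyGenus {n : ℕ} [NeZero n] (hn : 60 ≤ n) :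
    (twoGenera.data n).PolyGenus (fun v => ladderSign true v.1) (2 * n + 1) :=
  twoGeneraFaces.polyGenus twoGenera_coverGood hn (by ring)

theorem twoGenera_polyGenus' {n : ℕ} [NeZero n] (hn : 60 ≤ n) :
    (twoGenera.data n).PolyGenus (fun v => ladderSign false v.1) (3 * n + 1) :=
  twoGeneraFaces'.polyGenus twoGenera_coverGood' hn (by ring)

theorem highGenus_polyGenus {n : ℕ} [NeZero n] (hn : 60 ≤ n) :
    (highGenus.data n).PolyGenus (fun v => ladderSign true v.1) (3 * n + 1) :=
  highGenusFaces.polyGenus highGenus_coverGood hn (by ring)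

end LadderPair

open LadderPair

/-- The only polyhedral genera of `twoGenera.data n` are `2 * n + 1` and `3 * n + 1`. -/
theorem exists_gap (k : ℕ) : ∃ (V : Type) (G : SimpleGraph V), IsCubicGraph G ∧
    ∃ g g' : ℕ, g ∈ polyhedralGenera G ∧ g' ∈ polyhedralGenera G ∧ g + k ≤ g' ∧
      ∀ h : ℕ, g < h → h < g' → h ∉ polyhedralGenera G := by
  have hn : 60 ≤ k + 60 := by omega
  refine ⟨_, (twoGenera.data (k + 60)).graph,
    isCubicGraph _ (twoGenera_hasPentagons.connected _), 2 * (k + 60) + 1, 3 * (k + 60) + 1,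
    ⟨_, twoGenera_polyGenus hn⟩, ⟨_, twoGenera_polyGenus' hn⟩, by omega, ?_⟩
  intro h h1 h2 h3
  obtain ⟨b, hb⟩ := twoGenera_hasPentagons.exists_polyGenus h3
  cases b
  · exact h2.ne (hb.2.unique (twoGenera_polyGenus' hn).2)
  · exact h1.ne' (hb.2.unique (twoGenera_polyGenus hn).2)

/-- The graph `highGenus.data n` embeds in genus `2 * n + 1`, but its only polyhedral genus is
`3 * n + 1`. -/
theorem exists_high_genus (k : ℕ) : ∃ (V : Type) (G : SimpleGraph V), IsCubicGraph G ∧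
    ∃ m p : ℕ, IsLeast (embeddingGenera G) m ∧ IsLeast (polyhedralGenera G) p ∧ m + k ≤ p := by
  have hn : 60 ≤ k + 60 := by omega
  have h2 : 2 * (k + 60) + 1 ∈ embeddingGenera (highGenus.data (k + 60)).graph :=
    ⟨_, (highGenusFaces'.hasGenus_iff _).2 (by ring)⟩
  refine ⟨_, (highGenus.data (k + 60)).graph,
    isCubicGraph _ (highGenus_hasPentagons.connected _), _, 3 * (k + 60) + 1,
    ⟨Nat.sInf_mem ⟨_, h2⟩, fun g hg => Nat.sInf_le hg⟩, ⟨⟨_, highGenus_polyGenus hn⟩, ?_⟩, ?_⟩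
  · intro g hg
    obtain ⟨b, hb⟩ := highGenus_hasPentagons.exists_polyGenus hg
    cases b
    · exact absurd ((highGenusFaces'.coverLabelling _).good_of_isPolyhedral hb.1)
        (highGenus_not_good _)
    · exact ((highGenus_polyGenus hn).2.unique hb.2).le
  · have := Nat.sInf_le h2
    omega

/-! ### Many polyhedral genera -/

/-- The complete graph on four vertices. -/
def tetrahedron : CubicData (Fin 4) where
  inv d := (d.1 + Fin.ofNat 4 d.2.val + 1, 2 - d.2)
  inv_inv := by decide
  fst_ne := by decide
  inj := by decide

/-- The orientations of the embedding as a tetrahedron. -/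
def tetrahedronSign : Fin 4 → Bool := ![true, false, true, false]

/-- The four faces of the tetrahedron. -/
def tetrahedronFaces : FaceTable tetrahedron tetrahedronSign 4 where
  label d := ![![0, 1, 2], ![3, 0, 1], ![3, 2, 1], ![0, 3, 2]] d.1 d.2
  rank d := ![![0, 0, 0], ![0, 2, 1], ![2, 1, 2], ![1, 1, 2]] d.1 d.2
  rep := ![(0, 0), (0, 1), (0, 2), (1, 0)]
  label_face := by decide
  label_rep := by decide
  rank_face := by decide

theorem tetrahedron_polyGenus : tetrahedron.PolyGenus tetrahedronSign 0 :=
  ⟨Labelling.Good.isPolyhedral (ℓ := tetrahedronFaces.labelling)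
    ⟨by decide +kernel, by decide +kernel⟩,
    (tetrahedronFaces.labelling.hasGenus_iff _).2 (by simp)⟩

theorem tetrahedron_adj {u v : Fin 4} (h : u ≠ v) : tetrahedron.graph.Adj u v := by
  have : ∀ u v : Fin 4, u ≠ v → ∃ t, (tetrahedron.inv (u, t)).1 = v := by decide
  exact this u v h

theorem tetrahedron_connected : tetrahedron.graph.Connected := by
  refine connected_of_forall fun f hf u v => ?_
  by_cases h : u = v
  · rw [h]
  · obtain ⟨t, rfl⟩ := tetrahedron_adj h
    exact (hf (u, t)).symm

/-- A star product with `twoGenera.data 60` raises the genus by 121 or by 181, so `k` star products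
give `k + 1` genera. -/
theorem exists_polyGenus_family (k : ℕ) : ∃ (V : Type) (_ : Finite V) (G : CubicData V) (v : V),
    G.graph.Connected ∧ ∀ j ≤ k, ∃ τ : V → Bool, τ v = true ∧ G.PolyGenus τ (121 * k + 60 * j) := by
  induction k with
  | zero =>
    refine ⟨_, inferInstance, tetrahedron, 0, tetrahedron_connected, fun j hj => ?_⟩
    obtain rfl : j = 0 := by omega
    exact ⟨_, rfl, tetrahedron_polyGenus⟩
  | succ k ih =>
    obtain ⟨W, hW, G, v, hG, h⟩ := ih
    have h1 := twoGenera_polyGenus (n := 60) le_rfl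
    have h2 := twoGenera_polyGenus' (n := 60) le_rfl
    have hr : (((false, 0, 0), 1) : LadderVertex × ZMod 60) ≠ ((false, 0, 0), 0) := by decide
    refine ⟨_, inferInstance, star (twoGenera.data 60) ((false, 0, 0), 0) G v, Sum.inl ⟨_, hr⟩,
      ?_, fun j hj => ?_⟩
    · obtain ⟨τ, hv, hτ⟩ := h 0 (Nat.zero_le _)
      exact star_connected h1 hτ hv.symm (twoGenera_hasPentagons.connected 60) hG
    · rcases Nat.eq_zero_or_pos j with rfl | hj0
      · obtain ⟨τ, hv, hτ⟩ := h 0 (Nat.zero_le _)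
        refine ⟨starSign (fun x => ladderSign true x.1) τ, rfl, ?_⟩
        convert h1.star (w := ((false, 0, 0), 0)) hτ hv.symm using 1
        ring
      · obtain ⟨i, rfl⟩ := Nat.exists_eq_add_of_lt hj0
        obtain ⟨τ, hv, hτ⟩ := h i (by omega)
        refine ⟨starSign (fun x => ladderSign false x.1) τ, rfl, ?_⟩
        convert h2.star (w := ((false, 0, 0), 0)) hτ hv.symm using 1
        ring

theorem exists_many_genera (k : ℕ) : ∃ (V : Type) (G : SimpleGraph V), IsCubicGraph G ∧
    (k : ℕ∞) ≤ (polyhedralGenera G).encard := by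
  obtain ⟨V, hV, G, v, hG, h⟩ := exists_polyGenus_family k
  refine ⟨V, G.graph, isCubicGraph _ hG, ?_⟩
  have hinj : Function.Injective fun j : Fin k => 121 * k + 60 * j.val := by
    intro i j hij
    simp only at hij
    exact Fin.ext (by omega)
  have hsub : Set.range (fun j : Fin k => 121 * k + 60 * j.val) ⊆ polyhedralGenera G.graph := by
    rintro _ ⟨j, rfl⟩
    obtain ⟨τ, -, hτ⟩ := h j j.2.le
    exact ⟨_, hτ⟩
  refine le_trans (le_of_eq ?_) (Set.encard_le_encard hsub)
  rw [← Set.image_univ, hinj.encard_image, Set.encard_univ, ENat.card_eq_coe_fintype_card,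
    Fintype.card_fin]

/-! ### Eight embeddings in one genus -/

/-- The Heawood graph with the vertex `0` replaced by five vertices of a prism, which form the only
4-cycle `0, 1, 2, 3`, and with three further vertices replaced by triangles. The darts are numbered
by `3 * x + t`, and the table holds the number of the opposite dart. -/
def decoratedHeawood : CubicData (Fin 24) where
  inv d :=
    let k := entry
      0x38034321454030423d153f3a263c374739341a362d2e2c412b3233312f280c2a253b271e1f1d441c2324222019351b1213113e101718161400070b290d08020a0e0401064609050f
      (3 * d.1.val + d.2.val)
    (Fin.ofNat 24 (k / 3), Fin.ofNat 3 k)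
  inv_inv := by decide +kernel
  fst_ne := by decide +kernel
  inj := by decide +kernel

/-- The orientations of eight toroidal embeddings, one bit for each vertex. They come from the eight
polyhedral embeddings of the Heawood graph in the torus. -/
def heawoodSign (i : Fin 8) (x : Fin 24) : Bool :=
  (![0x13dfff, 0xc81fff, 0xaa2eff, 0x1e30ff, 0x87ef1f, 0xde011f, 0x4dfe1f, 0x7bce1f] i : ℕ).testBit x

/-- The faces of the eight embeddings. -/
def heawoodFaces (i : Fin 8) : FaceTable decoratedHeawood (heawoodSign i) 12 where
  label d := Fin.ofNat 12 (entry (![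
    0x903010709010a0701010a06090a060309060603070b0a070b07030b030a00030a0a0009080709080900080007070006050106050600050001040003040200040302020301020100,
    0x1030707030906030901060909010a07010a06070a060b030a0b06030b0a00030a0a0009080709080900080007070006050106050600050001040003040200040302020301020100,
    0x1030b06030b0b06090106090901070b0107070b000b0a09000a0b090a00000903070903080603080307080706000706050106050600050001040003040200040302020301020100,
    0x703010907010b0901010b06060b03030b07070b000b0a09000a0b090a00000903030906090807060809070806000706050106050600050001040003040200040302020301020100,
    0x1030b07030b00070b06000b09060b0b09010109070a00070a07090a0900000903060903080703080306080607070601060500010506000501040003040200040302020301020100,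
    0x103090903060b0306060b00000b09090b01010b070b0a03070a0b030a07000307090007090806070809060807070601060500010506000501040003040200040302020301020100,
    0xb0301010b09000b0906000909060303060b07060b0a000b0a0b070a0700000703030709080109080907080701060701060500010506000501040003040200040302020301020100,
    0xb0301010b09090b06060b00000b07030b070703060a09060a06030a0309000309070009080109080907080701060701060500010506000501040003040200040302020301020100] i) (3 * d.1.val + d.2.val))
  rank d := entry (![
    0x40106030505040404030505020604020303020307020305010604000502030601000401020206010005000601000701020206010008000901010207020301000802010007000000,
    0x60104030205050304030603020406050505020604040104030203050002030601000401020206010005000601000701020207010008000901010207020301000802010007000000,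
    0x60104040203020503030602010403050502010606010104050200050004030606040005020303010405000602070001020207010008000901010207020301000802010007000000,
    0x30106020405020304030306050403020502010606010104050200050004030605040704010105030200060002070001020207010008000901010206020301000702010007000000,
    0x60105030204060403020702010301000205040307020505010604000504030606040005020203010405000601000703010108020200090001010207020301000802010007000000,
    0x60103020204020303020306050405040505040607010104060200050005030604060403010105020200060001000703010107020200080001010207020301000802010007000000,
    0x30107060405060504020703020303020402010501020506010002000304030405040501020506010006000704060003010108020200090001010206020301000702010008000000,
    0x10107060206050303020406050503020002010306020404010504000503030602040401020507010005000604070003010107020200080001010207020301000802010008000000] i) (3 * d.1.val + d.2.val)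
  rep l :=
    let k := entry (![
    0x2c261f1d1a13110804020100,
    0x2b261f1d1a13110804020100,
    0x2d2b251d1913110804020100,
    0x2d2b1e1c1913110804020100,
    0x382c251d1a12100804020100,
    0x2d2b1e1c1a12100804020100,
    0x2e2c1f1d1912100804020100,
    0x372c1f1d1912100804020100] i) l
    (Fin.ofNat 24 (k / 3), Fin.ofNat 3 k)
  label_face := by revert i; decide +kernel
  label_rep := by revert i; decide +kernel
  rank_face := by revert i; decide +kernel

theorem heawoodFaces_good (i : Fin 8) : (heawoodFaces i).labelling.Good where
  vertex := by revert i; decide +kernel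
  edge := by revert i; decide +kernel

theorem heawood_polyGenus (i : Fin 8) : decoratedHeawood.PolyGenus (heawoodSign i) 1 :=
  ⟨(heawoodFaces_good i).isPolyhedral, ((heawoodFaces i).labelling.hasGenus_iff _).2 (by simp)⟩

/-! ### Automorphisms of star products -/

section Invariants

variable {V W : Type*}

/-- The vertex `x` lies on a triangle. -/
def InTriangle (A : SimpleGraph V) (x : V) : Prop :=
  ∃ y, A.Adj x y ∧ ∃ z, A.Adj y z ∧ A.Adj z x

/-- The vertex `x` lies on a 4-cycle. -/
def InSquare (A : SimpleGraph V) (x : V) : Prop :=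
  ∃ y, A.Adj x y ∧ ∃ u, A.Adj y u ∧ u ≠ x ∧ ∃ z, A.Adj u z ∧ z ≠ y ∧ A.Adj z x

theorem InTriangle.map {A : SimpleGraph V} {B : SimpleGraph W} (φ : A ≃g B) {x : V}
    (h : InTriangle A x) : InTriangle B (φ x) := by
  obtain ⟨y, h1, z, h2, h3⟩ := h
  exact ⟨φ y, φ.map_adj_iff.2 h1, φ z, φ.map_adj_iff.2 h2, φ.map_adj_iff.2 h3⟩

theorem InSquare.map {A : SimpleGraph V} {B : SimpleGraph W} (φ : A ≃g B) {x : V}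
    (h : InSquare A x) : InSquare B (φ x) := by
  obtain ⟨y, h1, u, h2, h3, z, h4, h5, h6⟩ := h
  exact ⟨φ y, φ.map_adj_iff.2 h1, φ u, φ.map_adj_iff.2 h2, φ.injective.ne h3, φ z,
    φ.map_adj_iff.2 h4, φ.injective.ne h5, φ.map_adj_iff.2 h6⟩

theorem inTriangle_map_iff {A : SimpleGraph V} {B : SimpleGraph W} (φ : A ≃g B) {x : V} :
    InTriangle B (φ x) ↔ InTriangle A x :=
  ⟨fun h => by simpa using h.map φ.symm, fun h => h.map φ⟩

theorem inSquare_map_iff {A : SimpleGraph V} {B : SimpleGraph W} (φ : A ≃g B) {x : V} :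
    InSquare B (φ x) ↔ InSquare A x :=
  ⟨fun h => by simpa using h.map φ.symm, fun h => h.map φ⟩

/-- All 4-cycles contain the vertex `v`. -/
def SquaresContain (A : SimpleGraph V) (v : V) : Prop :=
  ∀ a b, A.Adj a b → ∀ c, A.Adj b c → c ≠ a → ∀ d, A.Adj c d → d ≠ b → A.Adj d a →
    a = v ∨ b = v ∨ c = v ∨ d = v

/-- The only automorphism that fixes `v` and its neighbours is the identity. -/
def RigidAt (A : SimpleGraph V) (v : V) : Prop :=
  ∀ φ : A ≃g A, φ v = v → (∀ y, A.Adj v y → φ y = y) → ∀ x, φ x = x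

end Invariants

section StarGraph

variable {V W : Type*} {K : CubicData V} {w : V} {G : CubicData W} {v : W}

variable (K w G v) in
/-- The edges of the star product between the two factors. -/
def Port (x : V) (y : W) : Prop := ∃ t, (K.inv (w, t)).1 = x ∧ (G.inv (v, -t)).1 = y

theorem Port.adj_left {x y} (h : Port K w G v x y) : K.graph.Adj w x :=
  ⟨h.choose, h.choose_spec.1⟩

theorem exists_port_of_adj {y} (h : G.graph.Adj v y) : ∃ x, Port K w G v x y :=
  ⟨_, -h.choose, rfl, by rw [neg_neg]; exact h.choose_spec⟩

theorem Port.right_unique {x y y'} (h : Port K w G v x y) (h' : Port K w G v x y') : y = y' := by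
  obtain ⟨t, h1, rfl⟩ := h
  obtain ⟨t', h2, rfl⟩ := h'
  rw [K.inj w t t' (h1.trans h2.symm)]

theorem Port.left_unique {x x' y} (h : Port K w G v x y) (h' : Port K w G v x' y) : x = x' := by
  obtain ⟨t, rfl, h1⟩ := h
  obtain ⟨t', rfl, h2⟩ := h'
  rw [neg_injective (G.inj v _ _ (h1.trans h2.symm))]

theorem Port.inTriangle {x y x' y'} (h : Port K w G v x y) (h' : Port K w G v x' y')
    (ha : K.graph.Adj x x') : InTriangle K.graph w :=
  ⟨x, h.adj_left, x', ha, h'.adj_left.symm⟩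

variable (K w G v) in
/-- The adjacency relation of the star product, by the positions of the two vertices. -/
def StarAdj : StarVertex w v → StarVertex w v → Prop
  | Sum.inl x, Sum.inl y => K.graph.Adj x.1 y.1
  | Sum.inl x, Sum.inr y => Port K w G v x.1 y.1
  | Sum.inr y, Sum.inl x => Port K w G v x.1 y.1
  | Sum.inr x, Sum.inr y => G.graph.Adj x.1 y.1

theorem star_adj_cases {a b : StarVertex w v} (h : (star K w G v).graph.Adj a b) :
    StarAdj K w G v a b := by
  obtain ⟨t, rfl⟩ := h
  suffices key : ∀ e : StarVertex w v × Fin 3, StarAdj K w G v e.1 ((star K w G v).inv e).1 from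
    key (a, t)
  refine star_cases K w G v ?_ ?_ ?_ ?_
  · intro d h h'
    rw [star_inv_left K w G v h h']
    exact ⟨d.2, rfl⟩
  · intro t
    rw [star_inv_left_port]
    exact ⟨t, rfl, rfl⟩
  · intro d h h'
    rw [star_inv_right K w G v h h']
    exact ⟨d.2, rfl⟩
  · intro t
    rw [star_inv_right_port]
    exact ⟨-t, rfl, by rw [neg_neg]⟩

theorem star_adj_left {x y : {x // x ≠ w}} :
    (star K w G v).graph.Adj (Sum.inl x) (Sum.inl y) ↔ K.graph.Adj x.1 y.1 := by
  refine ⟨fun h => star_adj_cases h, ?_⟩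
  rintro ⟨t, ht⟩
  refine ⟨t, ?_⟩
  have := star_inv_left K w G v (d := (x.1, t)) x.2 (ht ▸ y.2)
  change ((star K w G v).inv (left (x.1, t) x.2)).1 = _
  rw [this]
  exact congrArg Sum.inl (Subtype.ext ht)

theorem star_adj_right {x y : {x // x ≠ v}} :
    (star K w G v).graph.Adj (Sum.inr x) (Sum.inr y) ↔ G.graph.Adj x.1 y.1 := by
  refine ⟨fun h => star_adj_cases h, ?_⟩
  rintro ⟨t, ht⟩
  refine ⟨t, ?_⟩
  have := star_inv_right K w G v (d := (x.1, t)) x.2 (ht ▸ y.2)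
  change ((star K w G v).inv (right (x.1, t) x.2)).1 = _
  rw [this]
  exact congrArg Sum.inr (Subtype.ext ht)

theorem star_adj_port {x : {x // x ≠ w}} {y : {y // y ≠ v}} :
    (star K w G v).graph.Adj (Sum.inl x) (Sum.inr y) ↔ Port K w G v x.1 y.1 := by
  refine ⟨fun h => star_adj_cases h, ?_⟩
  rintro ⟨t, h1, h2⟩
  refine ⟨(K.inv (w, t)).2, ?_⟩
  have h3 := congrArg Prod.fst (star_inv_left_port K w G v t)
  have h4 : left (K.inv (w, t)) (K.inv_fst_ne _ _) =
      ((Sum.inl x : StarVertex w v), (K.inv (w, t)).2) :=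
    Prod.ext (congrArg Sum.inl (Subtype.ext h1)) rfl
  rw [h4] at h3
  rw [h3]
  exact congrArg Sum.inr (Subtype.ext h2)

theorem star_adj_port' {x : {x // x ≠ w}} {y : {y // y ≠ v}} :
    (star K w G v).graph.Adj (Sum.inr y) (Sum.inl x) ↔ Port K w G v x.1 y.1 := by
  rw [SimpleGraph.adj_comm, star_adj_port]

/-- If `w` lies on no triangle, then no triangle of the star product uses edges between the
factors. -/
theorem inTriangle_star (hw : ¬ InTriangle K.graph w) (x : {x // x ≠ w}) :
    InTriangle (star K w G v).graph (Sum.inl x) ↔ InTriangle K.graph x.1 := by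
  constructor
  · rintro ⟨y | y, h1, z | z, h2, h3⟩ <;>
      simp only [star_adj_left, star_adj_right, star_adj_port, star_adj_port'] at h1 h2 h3
    · exact ⟨_, h1, _, h2, h3⟩
    · exact absurd (h3.inTriangle h2 h1) hw
    · exact absurd (h1.inTriangle h2 h3.symm) hw
    · exact absurd (h1.right_unique h3) h2.ne
  · rintro ⟨y, h1, z, h2, h3⟩
    have hy : y ≠ w := by
      rintro rfl
      exact hw ⟨z, h2, x, h3, h1⟩
    have hz : z ≠ w := by
      rintro rfl
      exact hw ⟨x, h3, y, h1, h2⟩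
    exact ⟨Sum.inl ⟨y, hy⟩, star_adj_left.2 h1, Sum.inl ⟨z, hz⟩, star_adj_left.2 h2,
      star_adj_left.2 h3⟩

theorem inSquare_star (hw : ¬ InTriangle K.graph w) (hw' : ¬ InSquare K.graph w)
    (x : {x // x ≠ w}) :
    InSquare (star K w G v).graph (Sum.inl x) ↔ InSquare K.graph x.1 := by
  constructor
  · rintro ⟨y | y, h1, u | u, h2, h3, z | z, h4, h5, h6⟩ <;>
      simp only [star_adj_left, star_adj_right, star_adj_port, star_adj_port', ne_eq, Sum.inl.injEq,
        Sum.inr.injEq, reduceCtorEq, not_false_eq_true, Subtype.ext_iff] at h1 h2 h3 h4 h5 h6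
    · exact ⟨_, h1, _, h2, h3, _, h4, h5, h6⟩
    · exact absurd (h4.left_unique h6) h3
    · exact absurd (h4.left_unique h2) h5
    · exact absurd (h6.inTriangle h2 h1) hw
    · exact absurd (h2.left_unique h1) h3
    · exact absurd (h2.left_unique h1) h3
    · exact absurd (h1.inTriangle h4 h6.symm) hw
    · exact absurd (h6.right_unique h1) h5
  · rintro ⟨y, h1, u, h2, h3, z, h4, h5, h6⟩
    have hy : y ≠ w := by
      rintro rfl
      exact hw' ⟨u, h2, z, h4, h5, x, h6, h3.symm, h1⟩
    have hu : u ≠ w := by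
      rintro rfl
      exact hw' ⟨z, h4, x, h6, h3.symm, y, h1, h5.symm, h2⟩
    have hz : z ≠ w := by
      rintro rfl
      exact hw' ⟨x, h6, y, h1, h5.symm, u, h2, h3, h4⟩
    exact ⟨Sum.inl ⟨y, hy⟩, star_adj_left.2 h1, Sum.inl ⟨u, hu⟩, star_adj_left.2 h2,
      fun h => h3 (congrArg Subtype.val (Sum.inl.inj h)), Sum.inl ⟨z, hz⟩, star_adj_left.2 h4,
      fun h => h5 (congrArg Subtype.val (Sum.inl.inj h)), star_adj_left.2 h6⟩

/-- A 4-cycle of the star product that uses edges between the factors would give a triangle of `K`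
through `w`, and the second factor without `v` has no 4-cycles. -/
theorem not_inSquare_star (hw : ¬ InTriangle K.graph w) (hG : SquaresContain G.graph v)
    (x : {x // x ≠ v}) : ¬ InSquare (star K w G v).graph (Sum.inr x) := by
  rintro ⟨y | y, h1, u | u, h2, h3, z | z, h4, h5, h6⟩ <;>
    simp only [star_adj_left, star_adj_right, star_adj_port, star_adj_port', ne_eq, Sum.inl.injEq,
      Sum.inr.injEq, reduceCtorEq, not_false_eq_true, Subtype.ext_iff] at h1 h2 h3 h4 h5 h6
  · exact h5 (h6.left_unique h1)
  · exact hw (h1.inTriangle h4 h2)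
  · exact h5 (h4.left_unique h2)
  · exact h3 (h2.right_unique h1)
  · exact hw (h2.inTriangle h6 h4)
  · exact h5 (h4.right_unique h2)
  · exact h3 (h4.right_unique h6)
  · rcases hG _ _ h1 _ h2 h3 _ h4 h5 h6 with h | h | h | h
    exacts [x.2 h, y.2 h, u.2 h, z.2 h]

theorem squaresContain_star (hw : ¬ InTriangle K.graph w) (hG : SquaresContain G.graph v)
    {r : {x // x ≠ w}} (hK : SquaresContain K.graph r.1) :
    SquaresContain (star K w G v).graph (Sum.inl r) := by
  intro a b h1 c h2 h3 d h4 h5 h6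
  rcases a with a | a
  swap
  · exact absurd ⟨b, h1, c, h2, h3, d, h4, h5, h6⟩ (not_inSquare_star hw hG a)
  rcases b with b | b
  swap
  · exact absurd ⟨c, h2, d, h4, h5, _, h6, h3.symm, h1⟩ (not_inSquare_star hw hG b)
  rcases c with c | c
  swap
  · exact absurd ⟨d, h4, _, h6, h3.symm, _, h1, h5.symm, h2⟩ (not_inSquare_star hw hG c)
  rcases d with d | d
  swap
  · exact absurd ⟨_, h6, _, h1, h5.symm, _, h2, h3, h4⟩ (not_inSquare_star hw hG d)
  simp only [star_adj_left, ne_eq, Sum.inl.injEq, Subtype.ext_iff] at h1 h2 h3 h4 h5 h6 ⊢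
  exact hK _ _ h1 _ h2 h3 _ h4 h5 h6

variable {φ : (star K w G v).graph ≃g (star K w G v).graph}

/-- An automorphism that fixes the first factor fixes everything if the second factor is rigid. -/
theorem eq_of_fixes_left (hG : RigidAt G.graph v) (hφ : ∀ x, φ (Sum.inl x) = Sum.inl x) (a) :
    φ a = a := by
  classical
  have h1 : ∀ y : {y // y ≠ v}, ∃ y' : {y // y ≠ v}, φ (Sum.inr y) = Sum.inr y' := by
    intro y
    rcases h : φ (Sum.inr y) with x | y'
    · rw [← hφ x] at h
      exact absurd (φ.injective h) Sum.inr_ne_inl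
    · exact ⟨y', rfl⟩
  choose f hf using h1
  have hfinj : Function.Injective f := by
    intro y y' h
    have : φ (Sum.inr y) = φ (Sum.inr y') := by rw [hf, hf, h]
    exact Sum.inr.inj (φ.injective this)
  have hfsurj : Function.Surjective f := by
    intro y
    obtain ⟨x | y', h⟩ := φ.surjective (Sum.inr y)
    · rw [hφ] at h
      exact absurd h Sum.inl_ne_inr
    · rw [hf] at h
      exact ⟨y', Sum.inr.inj h⟩
  have hfport : ∀ y : {y // y ≠ v}, G.graph.Adj v y → f y = y := by
    intro y hy
    obtain ⟨x, hx⟩ := exists_port_of_adj (K := K) (w := w) hy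
    have hxw : x ≠ w := hx.adj_left.ne'
    have h2 : (star K w G v).graph.Adj (Sum.inl ⟨x, hxw⟩) (Sum.inr y) := star_adj_port.2 hx
    rw [← φ.map_adj_iff, hφ, hf, star_adj_port] at h2
    exact Subtype.ext (h2.right_unique hx)
  have hfadj : ∀ y y', G.graph.Adj (f y).1 (f y').1 ↔ G.graph.Adj y.1 y'.1 := by
    intro y y'
    rw [← star_adj_right (K := K) (w := w), ← hf, ← hf, φ.map_adj_iff, star_adj_right]
  have hfport' : ∀ y : {y // y ≠ v}, G.graph.Adj v (f y) ↔ G.graph.Adj v y := by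
    intro y
    refine ⟨fun h => ?_, fun h => by rwa [hfport y h]⟩
    have := hfinj (hfport _ h)
    rwa [this] at h
  let g : W → W := fun y => if h : y ≠ v then (f ⟨y, h⟩).1 else v
  have hg : ∀ y : {y // y ≠ v}, g y.1 = (f y).1 := fun y => dif_pos y.2
  have hgv : g v = v := dif_neg (by simp)
  have hbij : Function.Bijective g := by
    constructor
    · intro y y' h
      by_cases hy : y = v <;> by_cases hy' : y' = v
      · rw [hy, hy']
      · rw [hy, hgv, hg ⟨y', hy'⟩] at h
        exact absurd h.symm (f ⟨y', hy'⟩).2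
      · rw [hy', hgv, hg ⟨y, hy⟩] at h
        exact absurd h (f ⟨y, hy⟩).2
      · rw [hg ⟨y, hy⟩, hg ⟨y', hy'⟩] at h
        exact congrArg Subtype.val (hfinj (Subtype.ext h))
    · intro y
      by_cases hy : y = v
      · exact ⟨v, hy ▸ hgv⟩
      · obtain ⟨y', h⟩ := hfsurj ⟨y, hy⟩
        exact ⟨y', by rw [hg, h]⟩
  let ψ : G.graph ≃g G.graph :=
    { toEquiv := Equiv.ofBijective g hbij
      map_rel_iff' := by
        intro y y'
        change G.graph.Adj (g y) (g y') ↔ G.graph.Adj y y'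
        by_cases hy : y = v <;> by_cases hy' : y' = v
        · rw [hy, hy', hgv]
        · rw [hy, hgv, hg ⟨y', hy'⟩, hfport']
        · rw [hy', hgv, hg ⟨y, hy⟩, SimpleGraph.adj_comm, hfport', SimpleGraph.adj_comm]
        · rw [hg ⟨y, hy⟩, hg ⟨y', hy'⟩, hfadj] }
  have hψ : ∀ y, g y = y := hG ψ hgv fun y hy => by
    have hyv : y ≠ v := hy.ne'
    change g y = y
    rw [hg ⟨y, hyv⟩, hfport ⟨y, hyv⟩ hy]
  rcases a with x | y
  · exact hφ x
  · rw [hf]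
    exact congrArg Sum.inr (Subtype.ext ((hg y).symm.trans (hψ y)))

/-- Rules by which the automorphisms of a star product that fix the vertex `r` fix the other
vertices of the first factor in the order of their ranks: a vertex is fixed if it is the only
candidate among the neighbours of a fixed vertex, or the only common neighbour of two fixed
vertices. Here `c` is some invariant. -/
def Determined (K : CubicData V) (w r : V) {X : Type*} (c : V → X) (ρ : V → ℕ) (b : V) : Prop :=
  b = r ∨
  (∃ u, u ≠ w ∧ ρ u < ρ b ∧ (∃ s, (K.inv (u, s)).1 = b) ∧ ∀ s, (K.inv (u, s)).1 ≠ w ∧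
    ((K.inv (u, s)).1 = b ∨ ρ (K.inv (u, s)).1 < ρ b ∨ c (K.inv (u, s)).1 ≠ c b)) ∨
  ∃ u, u ≠ w ∧ ρ u < ρ b ∧ (∃ s, (K.inv (u, s)).1 = b) ∧
    ∃ u', u' ≠ w ∧ ρ u' < ρ b ∧ u ≠ u' ∧ (∃ s, (K.inv (u', s)).1 = b) ∧
      ∀ s t, (K.inv (u, s)).1 = (K.inv (u', t)).1 → (K.inv (u, s)).1 = w ∨ (K.inv (u, s)).1 = b

theorem fixes_left_of_determined {r : V} {X : Type*} {c : V → X} {ρ : V → ℕ}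
    (hc : ∀ x x' : {x // x ≠ w}, φ (Sum.inl x) = Sum.inl x' → c x = c x')
    (hr : ∀ h : r ≠ w, φ (Sum.inl ⟨r, h⟩) = Sum.inl ⟨r, h⟩)
    (hρ : ∀ b, b ≠ w → Determined K w r c ρ b) (x : {x // x ≠ w}) :
    φ (Sum.inl x) = Sum.inl x := by
  obtain ⟨b, hb⟩ := x
  induction h : ρ b using Nat.strong_induction_on generalizing b with
  | _ k ih =>
    subst h
    have hfix : ∀ u (hu : u ≠ w), ρ u < ρ b → φ (Sum.inl ⟨u, hu⟩) = Sum.inl ⟨u, hu⟩ :=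
      fun u hu h => ih (ρ u) h u hu rfl
    have hadj : ∀ u (hu : u ≠ w), ρ u < ρ b → K.graph.Adj u b →
        (star K w G v).graph.Adj (Sum.inl ⟨u, hu⟩) (φ (Sum.inl ⟨b, hb⟩)) := by
      intro u hu h h'
      rw [← hfix u hu h, φ.map_adj_iff, star_adj_left]
      exact h'
    rcases hρ b hb with rfl | ⟨u, hu, h1, h2, h3⟩ | ⟨u, hu, h1, h2, u', hu', h1', hne, h2', h3⟩
    · exact hr hb
    · have h4 := hadj u hu h1 h2
      rcases h5 : φ (Sum.inl ⟨b, hb⟩) with x | y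
      · rw [h5, star_adj_left] at h4
        obtain ⟨s, hs⟩ := h4
        rcases (h3 s).2 with h6 | h6 | h6
        · exact congrArg Sum.inl (Subtype.ext (hs.symm.trans h6))
        · rw [hs] at h6
          rw [← hfix _ x.2 h6] at h5
          exact (congrArg Sum.inl (Sum.inl.inj (φ.injective h5))).symm
        · rw [hs] at h6
          exact absurd (hc _ _ h5).symm h6
      · rw [h5, star_adj_port] at h4
        obtain ⟨s, hs⟩ := h4.adj_left.symm
        exact absurd hs (h3 s).1
    · have h4 := hadj u hu h1 h2
      have h4' := hadj u' hu' h1' h2'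
      rcases h5 : φ (Sum.inl ⟨b, hb⟩) with x | y
      · rw [h5, star_adj_left] at h4 h4'
        obtain ⟨s, hs⟩ := h4
        obtain ⟨t, ht⟩ := h4'
        rcases h3 s t (hs.trans ht.symm) with h6 | h6
        · exact absurd (hs.symm.trans h6) x.2
        · exact congrArg Sum.inl (Subtype.ext (hs.symm.trans h6))
      · rw [h5, star_adj_port] at h4 h4'
        exact absurd (h4.left_unique h4') hne

end StarGraph

/-! ### The decorated Heawood graph is rigid -/

instance {V : Type*} [DecidableEq V] (C : CubicData V) : DecidableRel C.graph.Adj :=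
  fun u v => inferInstanceAs (Decidable (∃ t, (C.inv (u, t)).1 = v))

instance {V : Type*} [DecidableEq V] [Fintype V] (A : SimpleGraph V) [DecidableRel A.Adj] (x : V) :
    Decidable (InTriangle A x) :=
  inferInstanceAs (Decidable (∃ _, _))

instance {V : Type*} [DecidableEq V] [Fintype V] (A : SimpleGraph V) [DecidableRel A.Adj] (x : V) :
    Decidable (InSquare A x) :=
  inferInstanceAs (Decidable (∃ _, _))

instance {V : Type*} [DecidableEq V] [Fintype V] (A : SimpleGraph V) [DecidableRel A.Adj] (v : V) :
    Decidable (SquaresContain A v) :=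
  inferInstanceAs (Decidable (∀ _, _))

instance {V X : Type*} [DecidableEq V] [Fintype V] [DecidableEq X] (K : CubicData V) (w r : V)
    (c : V → X) (ρ : V → ℕ) (b : V) : Decidable (Determined K w r c ρ b) :=
  inferInstanceAs (Decidable (_ ∨ _))

/-- Whether a vertex lies on a triangle, and whether it lies on a 4-cycle. -/
def heawoodKind (x : Fin 24) : Bool × Bool :=
  (x ∈ [2, 3, 4, 5, 6, 7, 9, 10, 11, 14, 15, 16], x < 4)

theorem inTriangle_heawood (x) :
    InTriangle decoratedHeawood.graph x ↔ (heawoodKind x).1 = true := by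
  revert x; decide +kernel

theorem inSquare_heawood (x) :
    InSquare decoratedHeawood.graph x ↔ (heawoodKind x).2 = true := by
  revert x; decide +kernel

theorem squaresContain_heawood : SquaresContain decoratedHeawood.graph 0 := by
  decide +kernel

/-- An order in which the vertices are determined, starting with `0`. The vertex `8` is the one
deleted in the star product. -/
def heawoodRank : Fin 24 → ℕ :=
  ![0, 1, 2, 3, 4, 5, 20, 16, 0, 21, 11, 17, 9, 6, 7, 22, 18, 19, 12, 10, 13, 14, 15, 8]

theorem heawood_determined :
    ∀ b, b ≠ 8 → Determined decoratedHeawood 8 0 heawoodKind heawoodRank b := by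
  decide +kernel

theorem decoratedHeawood_connected : decoratedHeawood.graph.Connected := by
  -- the vertex `8` comes last in the ranking here
  let depth : Fin 24 → ℕ := fun x => if x = 8 then 24 else heawoodRank x
  have hd : ∀ x, x = 0 ∨ ∃ s, depth (decoratedHeawood.inv (x, s)).1 < depth x := by decide +kernel
  refine connected_of_forall fun f hf => ?_
  have h : ∀ x, f x = f 0 := by
    intro x
    induction hx : depth x using Nat.strong_induction_on generalizing x with
    | _ k ih =>
      subst hx
      rcases hd x with rfl | ⟨s, hs⟩
      · rfl
      · rw [← ih _ hs _ rfl, hf]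
  intro u v
  rw [h u, h v]

/-- The vertex `0` is the only one on a 4-cycle and on no triangle which has a neighbour on a
triangle and on no 4-cycle. -/
theorem heawood_kind_root : ∀ x, (heawoodKind x).2 = true → (heawoodKind x).1 = false → x ≠ 0 →
    ∀ s, (decoratedHeawood.inv (x, s)).1 ≠ 8 ∧
      heawoodKind (decoratedHeawood.inv (x, s)).1 ≠ (true, false) := by
  decide +kernel

theorem heawoodSign_root : ∀ i, heawoodSign i 0 = true := by decide +kernel

theorem heawoodSign_injOn : ∀ i j, (∀ x, x ≠ 8 → heawoodSign i x = heawoodSign j x) → i = j := by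
  decide +kernel

/-! ### Many embeddings in one genus -/

section Decorate

variable {W : Type*} {G : CubicData W} {v : W}

/-- A star product of the decorated Heawood graph with a graph that is rigid at `v` has no
nontrivial automorphisms. -/
theorem decoratedHeawood_star_rigid (hG : RigidAt G.graph v) (hG' : SquaresContain G.graph v)
    (φ : (star decoratedHeawood 8 G v).graph ≃g (star decoratedHeawood 8 G v).graph) (a) :
    φ a = a := by
  have hw : ¬ InTriangle decoratedHeawood.graph 8 := by
    rw [inTriangle_heawood]; decide
  have hw' : ¬ InSquare decoratedHeawood.graph 8 := by
    rw [inSquare_heawood]; decide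
  have hc : ∀ x x' : {x : Fin 24 // x ≠ 8}, φ (Sum.inl x) = Sum.inl x' →
      heawoodKind x = heawoodKind x' := by
    intro x x' h
    have h1 := inTriangle_map_iff φ (x := Sum.inl x)
    have h2 := inSquare_map_iff φ (x := Sum.inl x)
    rw [h, inTriangle_star hw, inTriangle_star hw, inTriangle_heawood, inTriangle_heawood] at h1
    rw [h, inSquare_star hw hw', inSquare_star hw hw', inSquare_heawood, inSquare_heawood] at h2
    exact Prod.ext (Bool.eq_iff_iff.2 h1.symm) (Bool.eq_iff_iff.2 h2.symm)
  refine eq_of_fixes_left hG (fixes_left_of_determined hc (fun h0 => ?_) heawood_determined) a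
  have hs : InSquare (star decoratedHeawood 8 G v).graph (φ (Sum.inl ⟨0, h0⟩)) := by
    rw [inSquare_map_iff, inSquare_star hw hw', inSquare_heawood]
    rfl
  rcases h1 : φ (Sum.inl ⟨0, h0⟩) with x | y
  · by_contra hne
    have hx : x.1 ≠ 0 := fun h => hne (congrArg Sum.inl (Subtype.ext h))
    have hk := hc _ _ h1
    -- the vertex `5` is the neighbour of `0` on a triangle and on no 4-cycle
    have h5 : (5 : Fin 24) ≠ 8 := by decide
    have h05 : decoratedHeawood.graph.Adj 0 5 := ⟨0, by decide +kernel⟩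
    have hadj : (star decoratedHeawood 8 G v).graph.Adj (φ (Sum.inl ⟨0, h0⟩))
        (φ (Sum.inl ⟨5, h5⟩)) := by
      rw [φ.map_adj_iff, star_adj_left]
      exact h05
    have hx' := heawood_kind_root x (by rw [← hk]; rfl) (by rw [← hk]; rfl) hx
    rw [h1] at hadj
    rcases h2 : φ (Sum.inl ⟨5, h5⟩) with z | z
    · rw [h2, star_adj_left] at hadj
      obtain ⟨s, hs⟩ := hadj
      refine (hx' s).2 ?_
      rw [hs, ← hc _ _ h2]
      rfl
    · rw [h2, star_adj_port] at hadj
      obtain ⟨s, hs⟩ := hadj.adj_left.symm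
      exact (hx' s).1 hs
  · rw [h1] at hs
    exact absurd hs (not_inSquare_star hw hG' y)

end Decorate

/-- In a graph without automorphisms, embeddings with the same orientation at some vertex are
isomorphic only if they are equal: the identity cannot reverse the orientation there. -/
theorem eq_of_isomorphic {V : Type*} {C : CubicData V} (hC : ∀ (φ : C.graph ≃g C.graph) x, φ x = x)
    {σ τ : V → Bool} {v : V} (hv : σ v = τ v) (h : (C.rot σ).Isomorphic (C.rot τ)) : σ = τ := by
  obtain ⟨φ, hφ⟩ := h
  have hd : ∀ d, φ.toHom.mapDart d = d := by
    intro d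
    apply SimpleGraph.Dart.ext
    exact Prod.ext (hC φ _) (hC φ _)
  simp only [hd] at hφ
  rcases hφ with hφ | hφ
  · exact C.rot_injective (RotationSystem.ext (Equiv.ext hφ))
  · rw [C.mirror_rot] at hφ
    have h1 := C.rot_injective (RotationSystem.ext (Equiv.ext hφ))
    rw [h1] at hv
    simp at hv

/-- Repeated star products with the decorated Heawood graph, starting from the tetrahedron: each one
raises the genus by one and multiplies the number of embeddings by eight. The embeddings are
normalized by their orientation at `v`, to tell them from their mirror images. -/
theorem exists_rigid_family (g : ℕ) : ∃ (V : Type) (_ : Finite V) (G : CubicData V) (v : V),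
    G.graph.Connected ∧ SquaresContain G.graph v ∧ RigidAt G.graph v ∧
    (g = 0 ∨ ∀ (φ : G.graph ≃g G.graph) x, φ x = x) ∧
    ∃ (ι : Type) (τ : ι → V → Bool), Nat.card ι = 8 ^ g ∧ Function.Injective τ ∧
      ∀ i, τ i v = true ∧ G.PolyGenus (τ i) g := by
  induction g with
  | zero =>
    refine ⟨_, inferInstance, tetrahedron, 0, tetrahedron_connected, by decide +kernel, ?_,
      Or.inl rfl, Unit, fun _ => tetrahedronSign, by simp, fun _ _ _ => rfl,
      fun _ => ⟨rfl, tetrahedron_polyGenus⟩⟩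
    intro φ h0 h x
    by_cases hx : x = 0
    · rw [hx, h0]
    · exact h x (tetrahedron_adj (Ne.symm hx))
  | succ g ih =>
    obtain ⟨W, hW, G, v, hG, hsq, hrig, -, ι, τ, hι, hτ, hpoly⟩ := ih
    have h0 : (0 : Fin 24) ≠ 8 := by decide
    have hrig' := decoratedHeawood_star_rigid hrig hsq
    have : Finite ι := Nat.finite_of_card_ne_zero (by rw [hι]; positivity)
    -- the embedding of `G`, reflected to match the orientation at the deleted vertex
    let ρ : Fin 8 → ι → W → Bool := fun i j y => heawoodSign i 8 == τ j y
    have hρv : ∀ i j, heawoodSign i 8 = ρ i j v := fun i j => by simp [ρ, (hpoly j).1]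
    have hρ : ∀ i j, G.PolyGenus (ρ i j) g := by
      intro i j
      cases h : heawoodSign i 8
      · convert (hpoly j).2.mirror using 1
        simp [ρ, h]
      · convert (hpoly j).2 using 1
        simp [ρ, h]
    have hK : ¬ InTriangle decoratedHeawood.graph 8 := by
      rw [inTriangle_heawood]; decide
    have hne : Nonempty ι := (Nat.card_pos_iff.1 (by rw [hι]; positivity)).1
    obtain ⟨j0⟩ := hne
    refine ⟨_, inferInstance, star decoratedHeawood 8 G v, Sum.inl ⟨0, h0⟩,
      star_connected (heawood_polyGenus 0) (hρ 0 j0) (hρv 0 j0) decoratedHeawood_connected hG,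
      squaresContain_star hK hsq squaresContain_heawood, fun φ _ _ => hrig' φ, Or.inr hrig',
      Fin 8 × ι, fun p => starSign (heawoodSign p.1) (ρ p.1 p.2), ?_, ?_, ?_⟩
    · rw [Nat.card_prod, hι, Nat.card_fin, pow_succ, mul_comm]
    · rintro ⟨i, j⟩ ⟨i', j'⟩ h
      obtain rfl : i = i' := heawoodSign_injOn i i' fun x hx => congrFun h (Sum.inl ⟨x, hx⟩)
      obtain rfl : j = j' := by
        apply hτ
        funext y
        by_cases hy : y = v
        · rw [hy, (hpoly j).1, (hpoly j').1]
        · have := congrFun h (Sum.inr ⟨y, hy⟩)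
          have h2 : (heawoodSign i 8 == τ j y) = (heawoodSign i 8 == τ j' y) := this
          revert h2
          cases heawoodSign i 8 <;> cases τ j y <;> cases τ j' y <;> decide
      rfl
    · rintro ⟨i, j⟩
      refine ⟨heawoodSign_root i, ?_⟩
      rw [add_comm]
      exact (heawood_polyGenus i).star (hρ i j) (hρv i j)

theorem exists_nonisomorphic (g : ℕ) : ∃ (V : Type) (C : CubicData V), IsCubicGraph C.graph ∧
    HasNonisomorphicPolyhedral C.graph g (8 ^ g) := by
  obtain ⟨V, hV, C, v, hC, -, -, hrig, ι, τ, hι, hτ, hpoly⟩ := exists_rigid_family g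
  have : Finite ι := Nat.finite_of_card_ne_zero (by rw [hι]; positivity)
  let e := Finite.equivFinOfCardEq hι
  refine ⟨V, C, isCubicGraph C hC, fun i => C.rot (τ (e.symm i)), fun i => (hpoly _).2, ?_⟩
  intro i j hij h
  rcases hrig with rfl | hrig
  · exact hij (Subsingleton.elim (α := Fin 1) i j)
  · refine hij (e.symm.injective (hτ (eq_of_isomorphic hrig (v := v) ?_ h)))
    rw [(hpoly _).1, (hpoly _).1]

end CubicData

theorem RotationSystem.isomorphic_of_mirror {V : Type*} {G : SimpleGraph V}
    {R S : RotationSystem G} (h : S = R ∨ S = R.mirror) : R.Isomorphic S := by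
  refine ⟨SimpleGraph.Iso.refl, ?_⟩
  rcases h with rfl | rfl
  · exact Or.inl fun d => rfl
  · refine Or.inr fun d => ?_
    rw [mirror_mirror]
    rfl

theorem HasNonisomorphicPolyhedral.mono {V : Type*} {G : SimpleGraph V} {g M N : ℕ} (hMN : M ≤ N)
    (h : HasNonisomorphicPolyhedral G g N) : HasNonisomorphicPolyhedral G g M := by
  obtain ⟨P, h1, h2⟩ := h
  exact ⟨fun i => P (Fin.castLE hMN i), fun i => h1 _, fun i j hij => h2 _ _ fun h =>
    hij (Fin.castLE_injective hMN h)⟩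

theorem HasNonisomorphicPolyhedral.le_numPolyhedral {V : Type*} [Finite V]
    {C : CubicData V} {g N : ℕ} (h : HasNonisomorphicPolyhedral C.graph g N) :
    N ≤ numPolyhedral C.graph g := by
  have : Finite (RotationSystem C.graph) :=
    Finite.of_surjective C.rot fun R => (C.exists_rot_eq R).imp fun _ h => h.symm
  obtain ⟨P, h1, h2⟩ := h
  have hinj : Function.Injective fun i =>
      (Quotient.mk (RotationSystem.mirrorSetoid C.graph) (P i)) := by
    intro i j hij
    by_contra hne
    exact h2 i j hne (RotationSystem.isomorphic_of_mirror (Quotient.exact hij))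
  have h3 :
      (Set.range fun i => Quotient.mk (RotationSystem.mirrorSetoid C.graph) (P i)).ncard = N := by
    rw [← Set.image_univ, Set.ncard_image_of_injective _ hinj, Set.ncard_univ, Nat.card_fin]
  rw [numPolyhedral]
  refine h3.symm.le.trans (Set.ncard_le_ncard ?_ (Set.toFinite _))
  rintro _ ⟨i, rfl⟩
  exact ⟨P i, h1 i, rfl⟩

theorem theorem3 :
    (∀ k : ℕ, 0 < k →
      -- (a)
      (∃ (V : Type) (G : SimpleGraph V), IsCubicGraph G ∧
        ∃ g g' : ℕ, g ∈ polyhedralGenera G ∧ g' ∈ polyhedralGenera G ∧ g + k ≤ g' ∧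
          ∀ h : ℕ, g < h → h < g' → h ∉ polyhedralGenera G) ∧
      -- (b)
      (∃ (V : Type) (G : SimpleGraph V), IsCubicGraph G ∧
        (k : ℕ∞) ≤ (polyhedralGenera G).encard) ∧
      -- (c), arbitrarily many embeddings in one genus
      (∃ (V : Type) (G : SimpleGraph V), IsCubicGraph G ∧
        ∃ g : ℕ, k ≤ numPolyhedral G g) ∧
      (∃ (V : Type) (G : SimpleGraph V), IsCubicGraph G ∧
        ∃ g : ℕ, HasNonisomorphicPolyhedral G g k) ∧
      -- (d)
      (∃ (V : Type) (G : SimpleGraph V), IsCubicGraph G ∧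
        ∃ m p : ℕ, IsLeast (embeddingGenera G) m ∧ IsLeast (polyhedralGenera G) p ∧
          m + k ≤ p)) ∧
    -- (c), at least `8 ^ g` embeddings in every genus `g`
    (∀ g : ℕ,
      (∃ (V : Type) (G : SimpleGraph V), IsCubicGraph G ∧ 8 ^ g ≤ numPolyhedral G g) ∧
      (∃ (V : Type) (G : SimpleGraph V), IsCubicGraph G ∧
        HasNonisomorphicPolyhedral G g (8 ^ g))) := by
  refine ⟨fun k _ => ?_, fun g => ?_⟩
  · obtain ⟨V, C, hC, h⟩ := CubicData.exists_nonisomorphic k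
    have := hC.finite
    have hk : k ≤ 8 ^ k := (Nat.lt_pow_self (by norm_num)).le
    exact ⟨CubicData.exists_gap k, CubicData.exists_many_genera k,
      ⟨V, C.graph, hC, k, hk.trans h.le_numPolyhedral⟩, ⟨V, C.graph, hC, k, h.mono hk⟩,
      CubicData.exists_high_genus k⟩
  · obtain ⟨V, C, hC, h⟩ := CubicData.exists_nonisomorphic g
    have := hC.finite
    exact ⟨⟨V, C.graph, hC, h.le_numPolyhedral⟩, ⟨V, C.graph, hC, h⟩⟩
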